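/- Conventions. Smooth manifolds are finite-dimensional, real, Hausdorff and of constant dimension. A map $\pi\colon M\to S$ from a smooth manifold to a set is a *$Q$-chart* if (a) whenever $\pi(x)=\pi(y)$ there is a diffeomorphism $h$ from an open neighbourhood $U$ of $x$ onto an open neighbourhood of $y$ with $h(x)=y$ and $\pi\circ h=\pi|_U$, and (b) for all smooth maps $f,h\colon T\to M$ from a smooth manifold $T$ with $\pi\circ f=\pi\circ h$, the set $\{f=h\}$ is open in $T$. Two $Q$-charts to $S$ are equivalent if their disjoint union is again a $Q$-chart. A *$Q$-manifold* is a set with an equivalence class of surjective $Q$-charts ($Q$-atlases). A map between $Q$-manifolds is $Q$-smooth (a $Q$-submersion, a $Q$-immersion) if near every point it lifts through $Q$-charts to a smooth map (that is a submersion, an immersion at the corresponding point). A subset $V$ of a $Q$-manifold $S$ with a $Q$-manifold structure is an *immersed $Q$-submanifold* if the inclusion is a $Q$-immersion and every $Q$-smooth map from a smooth manifold to $S$ with values in $V$ is $Q$-smooth into $V$; such a structure on $V$ is unique. A *$Q$-group* is a group that is a $Q$-manifold with $Q$-smooth multiplication and inversion. A *$Q$-principal bundle* $\beta\colon P\to M$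 with structure group a $Q$-group $G$ consists of a $Q$-manifold $P$ with a free $Q$-smooth right $G$-action and a $Q$-smooth map $\beta$ to a smooth manifold $M$ such that $\beta^{-1}(\beta(p))=pG$ for all $p\in P$ and every point of $M$ has an open neighbourhood $U$ with a $G$-equivariant $Q$-diffeomorphism $\beta^{-1}(U)\to U\times G$ over $U$. Its *gauge groupoid* is $(P\times P)/G\rightrightarrows M$ (quotient by the diagonal action), with $\mathbf s[p,q]=\beta(q)$, $\mathbf t[p,q]=\beta(p)$, $[p,q][q,r]=[p,r]$, $\mathbf 1_{\beta(p)}=[p,p]$, $[p,q]^{-1}=[q,p]$, and with the unique $Q$-manifold structure for which the quotient map $P\times P\to(P\times P)/G$ is a $Q$-submersion. A *$Q$-groupoid* $\mathcal G\rightrightarrows M$ is a groupoid whose total space $\mathcal G$ is a $Q$-manifold and whose base $M$ is a smooth manifold, such that the source $\mathbf s$, the inversion and the identity section are $Q$-smooth, $\mathbf s$ is a $Q$-submersion, and the multiplication is $Q$-smooth on the immersed $Q$-submanifold $\mathcal G^{(2)}=\{(g,h):\mathbf s(g)=\mathbf t(h)\}$ of $\mathcal G\times\mathcal G$. It is *locally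 trivial* if $(\mathbf s,\mathbf t)\colon\mathcal G\to M\times M$ is a surjective $Q$-submersion. For $x\in M$ put $\mathcal G(x,-)=\mathbf s^{-1}(x)$, $\mathcal G(x)=\{g:\mathbf s(g)=\mathbf t(g)=x\}$ and $\mathbf t_x=\mathbf t|_{\mathcal G(x,-)}$. An isomorphism of $Q$-groupoids is an isomorphism of groupoids that is $Q$-smooth together with its inverse. **Theorem.** Let $\mathcal G\rightrightarrows M$ be a locally trivial $Q$-groupoid. Then there is an isomorphism of $Q$-groupoids, over the identity of $M$, from the gauge groupoid of some $Q$-principal bundle over $M$ to $\mathcal G\rightrightarrows M$. More precisely, for every $x\in M$ the sets $\mathcal G(x,-)$ and $\mathcal G(x)$ are immersed $Q$-submanifolds of $\mathcal G$; with these structures $\mathcal G(x)$ is a $Q$-group and $\mathbf t_x\colon\mathcal G(x,-)\to M$ is a $Q$-principal bundle with structure group $\mathcal G(x)$ acting by $(h,g)\mapsto hg$; its gauge groupoid is a $Q$-groupoid, and $$\bigl(\mathcal G(x,-)\times\mathcal G(x,-)\bigr)/\mathcal G(x)\to\mathcal G,\qquad [g,h]\mapsto gh^{-1},$$ is a well-defined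 isomorphism of $Q$-groupoids over the identity of $M$. -/

import Mathlib

open scoped Manifold ContDiff Topology

universe u

/-! ### Smooth manifolds -/

/-- A finite-dimensional real smooth manifold (Hausdorff, without boundary), bundled. -/
structure SmoothMfd where
  /-- the model vector space -/
  E : Type
  /-- the underlying set -/
  carrier : Type u
  [normE : NormedAddCommGroup E]
  [spaceE : NormedSpace ℝ E]
  [finE : FiniteDimensional ℝ E]
  [top : TopologicalSpace carrier]
  [t2 : T2Space carrier]
  [charted : ChartedSpace E carrier]
  [smooth : IsManifold 𝓘(ℝ, E) ∞ carrier]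

namespace SmoothMfd

attribute [instance] normE spaceE finE top t2 charted smooth

instance : CoeSort SmoothMfd.{u} (Type u) := ⟨SmoothMfd.carrier⟩

/-- Smooth maps between smooth manifolds. -/
abbrev Smooth {M N : SmoothMfd.{u}} (f : M → N) : Prop :=
  ContMDiff 𝓘(ℝ, M.E) 𝓘(ℝ, N.E) ∞ f

/-- Diffeomorphisms from an open subset of `M` (the `source`) onto an open subset of `N`
(the `target`). -/
abbrev LocalDiffeo (M N : SmoothMfd.{u}) : Type u :=
  PartialDiffeomorph 𝓘(ℝ, M.E) 𝓘(ℝ, N.E) M N ∞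

/-- The product of two smooth manifolds. -/
noncomputable def prod (M N : SmoothMfd.{u}) : SmoothMfd.{u} :=
  letI : ChartedSpace (M.E × N.E) (M × N) :=
    inferInstanceAs (ChartedSpace (ModelProd M.E N.E) (M × N))
  { E := M.E × N.E
    carrier := M × N
    smooth := by
      rw [modelWithCornersSelf_prod]
      exact inferInstanceAs
        (IsManifold ((𝓘(ℝ, M.E)).prod 𝓘(ℝ, N.E)) ∞ (M × N)) }

/-- An open subset of a smooth manifold, as a smooth manifold. -/
noncomputable def restrict (M : SmoothMfd.{u}) (U : TopologicalSpace.Opens M) : SmoothMfd.{u} where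
  E := M.E
  carrier := U

/-- The inclusion of an open subset. -/
def incl (M : SmoothMfd.{u}) (U : TopologicalSpace.Opens M) : M.restrict U → M :=
  fun x : U => (x : M)

end SmoothMfd

/-! ### Q-charts and Q-manifolds -/

/-- A Q-chart `π : M → S` from a smooth manifold to a set. -/
structure IsQChart {M : SmoothMfd.{u}} {S : Type u} (π : M → S) : Prop where
  /-- points of the same fibre are related by a transverse local diffeomorphism -/
  transverse : ∀ x y : M, π x = π y →
    ∃ h : SmoothMfd.LocalDiffeo M M, x ∈ h.source ∧ h x = y ∧ ∀ z ∈ h.source, π (h z) = π z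
  /-- two smooth maps with the same projection coincide on an open set -/
  isOpen_eqLocus : ∀ (T : SmoothMfd.{u}) (f h : T → M), SmoothMfd.Smooth f → SmoothMfd.Smooth h →
    π ∘ f = π ∘ h → IsOpen {t | f t = h t}

/-- A smooth manifold together with a Q-chart defined on it. -/
structure QChart (S : Type u) where
  /-- the domain of the chart -/
  M : SmoothMfd.{u}
  /-- the chart -/
  π : M → S
  isQChart : IsQChart π

/-- Equivalence of two Q-charts `c` and `d`: their disjoint union satisfies the conditions of a
Q-chart. As `c` and `d` are Q-charts, this only means that any two points of the two domains which
have the same image in `S` are related by a transverse local diffeomorphism. -/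
def QChart.Equivalent {S : Type u} (c d : QChart S) : Prop :=
  ∀ (x : c.M) (y : d.M), c.π x = d.π y →
    ∃ h : SmoothMfd.LocalDiffeo c.M d.M,
      x ∈ h.source ∧ h x = y ∧ ∀ z ∈ h.source, d.π (h z) = c.π z

/-- A Q-manifold: a set with an equivalence class of Q-atlases (surjective Q-charts), given by a
representative. All the notions below only depend on the equivalence class. -/
class QManifold (S : Type u) where
  /-- a Q-atlas -/
  atlas : QChart S
  surjective_atlas : Function.Surjective atlas.π

/-- The Q-charts of a Q-manifold `S`: those which are equivalent to its Q-atlas. -/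
def QChart.IsChartOf {S : Type u} (c : QChart S) (Q : QManifold S) : Prop :=
  c.Equivalent Q.atlas

/-- Every smooth manifold is a Q-manifold, the identity being a Q-atlas. -/
instance SmoothMfd.instQManifold (N : SmoothMfd.{u}) : QManifold N where
  atlas :=
    { M := N
      π := id
      isQChart :=
        { transverse := by
            rintro x y rfl
            exact ⟨(Diffeomorph.refl 𝓘(ℝ, N.E) N ∞).toPartialDiffeomorph,
              trivial, rfl, fun _ _ => rfl⟩
          isOpen_eqLocus := by
            intro T f h _ _ e
            have : {t | f t = h t} = Set.univ := Set.eq_univ_of_forall fun t => congrFun e t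
            rw [this]
            exact isOpen_univ } }
  surjective_atlas := Function.surjective_id

theorem SmoothMfd.smooth_fst (M N : SmoothMfd.{u}) :
    SmoothMfd.Smooth (M := M.prod N) (N := M) (Prod.fst : M × N → M) := by
  have := contMDiff_fst (I := 𝓘(ℝ, M.E)) (J := 𝓘(ℝ, N.E)) (M := M) (N := N) (n := ∞)
  rw [← modelWithCornersSelf_prod] at this
  exact this

theorem SmoothMfd.smooth_snd (M N : SmoothMfd.{u}) :
    SmoothMfd.Smooth (M := M.prod N) (N := N) (Prod.snd : M × N → N) := by
  have := contMDiff_snd (I := 𝓘(ℝ, M.E)) (J := 𝓘(ℝ, N.E)) (M := M) (N := N) (n := ∞)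
  rw [← modelWithCornersSelf_prod] at this
  exact this

/-- The product of two local diffeomorphisms. -/
noncomputable def SmoothMfd.LocalDiffeo.prod {M N M' N' : SmoothMfd.{u}}
    (h : SmoothMfd.LocalDiffeo M M') (k : SmoothMfd.LocalDiffeo N N') :
    SmoothMfd.LocalDiffeo (M.prod N) (M'.prod N') where
  toPartialEquiv := h.toPartialEquiv.prod k.toPartialEquiv
  open_source := h.open_source.prod k.open_source
  open_target := h.open_target.prod k.open_target
  contMDiffOn_toFun := by
    have := h.contMDiffOn_toFun.prodMap k.contMDiffOn_toFun
    rw [← modelWithCornersSelf_prod, ← modelWithCornersSelf_prod] at this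
    exact this
  contMDiffOn_invFun := by
    have := h.contMDiffOn_invFun.prodMap k.contMDiffOn_invFun
    rw [← modelWithCornersSelf_prod, ← modelWithCornersSelf_prod] at this
    exact this

/-- The product of two Q-manifolds, with the product of the Q-atlases as Q-atlas. -/
noncomputable instance QManifold.instProd {S S' : Type u} [Q : QManifold S] [Q' : QManifold S'] :
    QManifold (S × S') where
  atlas :=
    { M := Q.atlas.M.prod Q'.atlas.M
      π := Prod.map Q.atlas.π Q'.atlas.π
      isQChart :=
        { transverse := by
            rintro ⟨x, x'⟩ ⟨y, y'⟩ e
            obtain ⟨h, hx, hy, hz⟩ := Q.atlas.isQChart.transverse x y (congrArg Prod.fst e)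
            obtain ⟨k, kx, ky, kz⟩ := Q'.atlas.isQChart.transverse x' y' (congrArg Prod.snd e)
            exact ⟨h.prod k, ⟨hx, kx⟩, Prod.ext hy ky,
              fun z hz' => Prod.ext (hz _ hz'.1) (kz _ hz'.2)⟩
          isOpen_eqLocus := by
            intro T f h hf hh e
            have h1 := Q.atlas.isQChart.isOpen_eqLocus T _ _
              ((SmoothMfd.smooth_fst _ _).comp hf) ((SmoothMfd.smooth_fst _ _).comp hh)
              (funext fun t => congrArg Prod.fst (congrFun e t))
            have h2 := Q'.atlas.isQChart.isOpen_eqLocus T _ _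
              ((SmoothMfd.smooth_snd _ _).comp hf) ((SmoothMfd.smooth_snd _ _).comp hh)
              (funext fun t => congrArg Prod.snd (congrFun e t))
            convert h1.inter h2 using 1
            ext t
            exact Prod.ext_iff } }
  surjective_atlas := Q.surjective_atlas.prodMap Q'.surjective_atlas

/-! ### Maps between Q-manifolds -/

section Maps

variable {S S' : Type u} [Q : QManifold S] [Q' : QManifold S']

/-- `f` is Q-smooth: near every point it lifts through Q-charts to a smooth map. -/
def QSmooth (f : S → S') : Prop :=
  ∀ s : S, ∃ (c : QChart S) (c' : QChart S') (F : c.M → c'.M) (m : c.M),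
    c.IsChartOf Q ∧ c'.IsChartOf Q' ∧ c.π m = s ∧ f ∘ c.π = c'.π ∘ F ∧ SmoothMfd.Smooth F

/-- `f` is a Q-submersion: near every point it lifts through Q-charts to a smooth map which is a
submersion there. -/
def QSubmersion (f : S → S') : Prop :=
  ∀ s : S, ∃ (c : QChart S) (c' : QChart S') (F : c.M → c'.M) (m : c.M),
    c.IsChartOf Q ∧ c'.IsChartOf Q' ∧ c.π m = s ∧ f ∘ c.π = c'.π ∘ F ∧ SmoothMfd.Smooth F ∧
      Manifold.IsSubmersionAt 𝓘(ℝ, c.M.E) 𝓘(ℝ, c'.M.E) ∞ F m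

/-- `f` is a Q-immersion: near every point it lifts through Q-charts to a smooth map which is an
immersion there. -/
def QImmersion (f : S → S') : Prop :=
  ∀ s : S, ∃ (c : QChart S) (c' : QChart S') (F : c.M → c'.M) (m : c.M),
    c.IsChartOf Q ∧ c'.IsChartOf Q' ∧ c.π m = s ∧ f ∘ c.π = c'.π ∘ F ∧ SmoothMfd.Smooth F ∧
      Manifold.IsImmersionAt 𝓘(ℝ, c.M.E) 𝓘(ℝ, c'.M.E) ∞ F m

/-- Q-smoothness of a map defined on a subset `V` of a Q-manifold: its composition with every
Q-smooth map from a smooth manifold to `S` with values in `V` is Q-smooth. When `V` is an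
immersed Q-submanifold, this is Q-smoothness for the Q-manifold structure of `V`. -/
def QSmoothOn (V : Set S) (f : V → S') : Prop :=
  ∀ (T : SmoothMfd.{u}) (c : T → S) (hc : ∀ t, c t ∈ V), QSmooth c →
    QSmooth fun t => f ⟨c t, hc t⟩

/-- The subset `V`, with the given Q-manifold structure on it, is an immersed Q-submanifold of `S`:
the inclusion is a Q-immersion, and Q-smooth maps from smooth manifolds to `S` with values in `V`
are Q-smooth as maps to `V`. This determines the Q-manifold structure of `V`. -/
structure IsImmersedQSubmanifold (V : Set S) (QV : QManifold V) : Prop where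
  immersion : QImmersion (Subtype.val : V → S)
  initial : QSmoothOn V (id : V → V)

end Maps

/-- A Q-group: a Q-manifold with a group structure whose operations are Q-smooth. -/
structure IsQGroup (G : Type u) [Group G] [QManifold G] : Prop where
  mul_smooth : QSmooth fun p : G × G => p.1 * p.2
  inv_smooth : QSmooth fun g : G => g⁻¹

/-! ### Groupoids -/

/-- A groupoid with base `M` and total space `𝒢`. -/
structure GroupoidOver (𝒢 M : Type u) where
  /-- the source map -/
  src : 𝒢 → M
  /-- the target map -/
  tgt : 𝒢 → M
  /-- the multiplication, defined on composable pairs -/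
  mul : (g h : 𝒢) → src g = tgt h → 𝒢
  /-- the identity section -/
  one : M → 𝒢
  /-- the inversion -/
  inv : 𝒢 → 𝒢
  src_mul : ∀ g h e, src (mul g h e) = src h
  tgt_mul : ∀ g h e, tgt (mul g h e) = tgt g
  mul_assoc : ∀ g h k (e : src g = tgt h) (e' : src h = tgt k),
    mul (mul g h e) k ((src_mul g h e).trans e') = mul g (mul h k e') (e.trans (tgt_mul h k e').symm)
  src_one : ∀ x, src (one x) = x
  tgt_one : ∀ x, tgt (one x) = x
  mul_one : ∀ g, mul g (one (src g)) (tgt_one _).symm = g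
  one_mul : ∀ g, mul (one (tgt g)) g (src_one _) = g
  src_inv : ∀ g, src (inv g) = tgt g
  tgt_inv : ∀ g, tgt (inv g) = src g
  mul_inv : ∀ g, mul g (inv g) (tgt_inv g).symm = one (tgt g)
  inv_mul : ∀ g, mul (inv g) g (src_inv g) = one (src g)

namespace GroupoidOver

section Algebra

variable {𝒢 M : Type u} (Γ : GroupoidOver 𝒢 M)

/-- The set `𝒢⁽²⁾` of composable pairs. -/
def composable : Set (𝒢 × 𝒢) := {p | Γ.src p.1 = Γ.tgt p.2}

/-- The source fibre `𝒢(x,-)`. -/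
def srcFibre (x : M) : Set 𝒢 := {g | Γ.src g = x}

/-- The isotropy group `𝒢(x)`, as a set. -/
def isotropy (x : M) : Set 𝒢 := {g | Γ.src g = x ∧ Γ.tgt g = x}

/-- The restriction `𝒢(x,-) → M` of the target map. -/
def tgtAt (x : M) (g : Γ.srcFibre x) : M := Γ.tgt g

theorem mul_congr {g g' h h' : 𝒢} (hg : g = g') (hh : h = h') (e : Γ.src g = Γ.tgt h) :
    Γ.mul g h e = Γ.mul g' h' (hg ▸ hh ▸ e) := by
  subst hg hh
  rfl

/-- The group structure of the isotropy group `𝒢(x)`, given by the groupoid operations. -/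
instance isotropyGroup (x : M) : Group (Γ.isotropy x) where
  mul g h := ⟨Γ.mul g h (g.2.1.trans h.2.2.symm),
    (Γ.src_mul _ _ _).trans h.2.1, (Γ.tgt_mul _ _ _).trans g.2.2⟩
  one := ⟨Γ.one x, Γ.src_one x, Γ.tgt_one x⟩
  inv g := ⟨Γ.inv g, (Γ.src_inv _).trans g.2.2, (Γ.tgt_inv _).trans g.2.1⟩
  mul_assoc g h k := Subtype.ext (Γ.mul_assoc _ _ _ _ _)
  one_mul := by
    rintro ⟨g, hs, ht⟩
    refine Subtype.ext ((Γ.mul_congr (congrArg Γ.one ht.symm) rfl _).trans (Γ.one_mul g))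
  mul_one := by
    rintro ⟨g, hs, ht⟩
    refine Subtype.ext ((Γ.mul_congr rfl (congrArg Γ.one hs.symm) _).trans (Γ.mul_one g))
  inv_mul_cancel := by
    rintro ⟨g, hs, ht⟩
    exact Subtype.ext ((Γ.inv_mul g).trans (congrArg Γ.one hs))

/-- The right action `(h, g) ↦ hg` of the isotropy group `𝒢(x)` on the source fibre `𝒢(x,-)`. -/
def fibreAct (x : M) (h : Γ.srcFibre x) (g : Γ.isotropy x) : Γ.srcFibre x :=
  ⟨Γ.mul h g (h.2.trans g.2.2.symm), (Γ.src_mul _ _ _).trans g.2.1⟩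

end Algebra

section Smooth

variable {N : SmoothMfd.{u}} {𝒢 : Type u} [QManifold 𝒢] (Γ : GroupoidOver 𝒢 N)

/-- A Q-groupoid over a smooth manifold `N`. The set of composable pairs is considered as an
immersed Q-submanifold of `𝒢 × 𝒢`. -/
structure IsQGroupoid : Prop where
  src_smooth : QSmooth Γ.src
  inv_smooth : QSmooth Γ.inv
  one_smooth : QSmooth Γ.one
  src_submersion : QSubmersion Γ.src
  mul_smooth : QSmoothOn Γ.composable fun p => Γ.mul p.1.1 p.1.2 p.2

/-- A locally trivial Q-groupoid: `(s,t) : 𝒢 → N × N` is a surjective Q-submersion. -/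
structure IsLocallyTrivial : Prop where
  isQGroupoid : Γ.IsQGroupoid
  surjective : Function.Surjective fun g => (Γ.src g, Γ.tgt g)
  submersion : QSubmersion fun g => (Γ.src g, Γ.tgt g)

/-- A morphism of Q-groupoids, over a map `φ` between the bases. -/
structure IsQMorphism {N' : SmoothMfd.{u}} {𝒢' : Type u} [QManifold 𝒢'] (Γ : GroupoidOver 𝒢 N)
    (Γ' : GroupoidOver 𝒢' N') (Φ : 𝒢 → 𝒢') (φ : N → N') : Prop where
  src_map : ∀ g, Γ'.src (Φ g) = φ (Γ.src g)
  tgt_map : ∀ g, Γ'.tgt (Φ g) = φ (Γ.tgt g)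
  mul_map : ∀ g h e, Φ (Γ.mul g h e) =
    Γ'.mul (Φ g) (Φ h) ((src_map g).trans ((congrArg φ e).trans (tgt_map h).symm))
  one_map : ∀ x, Φ (Γ.one x) = Γ'.one (φ x)
  smooth : QSmooth Φ

/-- An isomorphism of Q-groupoids over the same base `N`, inducing the identity of `N`. -/
structure IsQIsomorphism {𝒢' : Type u} [QManifold 𝒢'] (Γ : GroupoidOver 𝒢 N)
    (Γ' : GroupoidOver 𝒢' N) (Φ : 𝒢 ≃ 𝒢') : Prop where
  hom : IsQMorphism Γ Γ' Φ id
  inv : IsQMorphism Γ' Γ Φ.symm id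

end Smooth

end GroupoidOver

/-! ### Q-principal bundles and their gauge groupoids -/

/-- A Q-principal bundle `β : P → N` whose structure group is the Q-group `G`, with the right
action `act`. -/
structure IsQPrincipalBundle {N : SmoothMfd.{u}} {P G : Type u} [QManifold P] [Group G]
    [QManifold G] (act : P → G → P) (β : P → N) : Prop where
  isQGroup : IsQGroup G
  act_one : ∀ p, act p 1 = p
  act_mul : ∀ p g h, act p (g * h) = act (act p g) h
  act_free : ∀ p g, act p g = p → g = 1
  act_smooth : QSmooth fun q : P × G => act q.1 q.2
  proj_smooth : QSmooth β
  fibre_eq_orbit : ∀ p, β ⁻¹' {β p} = Set.range (act p)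
  /-- `G`-equivariant local trivializations `ψ : β⁻¹(U) → U × G`, Q-smooth in both directions -/
  locally_trivial : ∀ n : N, ∃ U : TopologicalSpace.Opens N, n ∈ U ∧
    ∃ ψ : ↥(β ⁻¹' (U : Set N)) ≃ (N.restrict U) × G,
      QSmoothOn (β ⁻¹' (U : Set N)) ψ ∧
      QSmooth (fun y => (ψ.symm y : P)) ∧
      (∀ p, N.incl U (ψ p).1 = β p) ∧
      ∀ p p' : ↥(β ⁻¹' (U : Set N)), ∀ g : G, (p' : P) = act p g →
        ψ p' = ((ψ p).1, (ψ p).2 * g)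

namespace IsQPrincipalBundle

variable {N : SmoothMfd.{u}} {P G : Type u} [QManifold P] [Group G] [QManifold G]
  {act : P → G → P} {β : P → N}
theorem proj_act (B : IsQPrincipalBundle act β) (p : P) (g : G) : β (act p g) = β p := by
  have : act p g ∈ β ⁻¹' {β p} := B.fibre_eq_orbit p ▸ Set.mem_range_self g
  exact this

theorem exists_act (B : IsQPrincipalBundle act β) {p q : P} (e : β p = β q) : ∃ g, act q g = p := by
  have : p ∈ β ⁻¹' {β q} := e
  rwa [B.fibre_eq_orbit q] at this

theorem act_inj (B : IsQPrincipalBundle act β) {p : P} {g h : G} (e : act p g = act p h) : g = h := by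
  have : act p (g * h⁻¹) = p := by
    rw [B.act_mul, e, ← B.act_mul, mul_inv_cancel, B.act_one]
  exact mul_inv_eq_one.mp (B.act_free _ _ this)

theorem proj_surjective (B : IsQPrincipalBundle act β) : Function.Surjective β := by
  intro n
  obtain ⟨U, hn, ψ, -, -, h, -⟩ := B.locally_trivial n
  exact ⟨ψ.symm ((⟨n, hn⟩ : U), 1), (h _).symm.trans (by rw [Equiv.apply_symm_apply]; rfl)⟩

/-- The orbit equivalence relation of the diagonal action of `G` on `P × P`. -/
def gaugeSetoid (B : IsQPrincipalBundle act β) : Setoid (P × P) where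
  r a b := ∃ g, b = (act a.1 g, act a.2 g)
  iseqv :=
    { refl := fun a => ⟨1, by rw [B.act_one, B.act_one]⟩
      symm := by
        rintro a _ ⟨g, rfl⟩
        refine ⟨g⁻¹, ?_⟩
        simp only [← B.act_mul, mul_inv_cancel, B.act_one]
      trans := by
        rintro a _ _ ⟨g, rfl⟩ ⟨h, rfl⟩
        exact ⟨g * h, by simp only [B.act_mul]⟩ }

/-- The quotient set `(P × P)/G`. -/
def GaugeSpace (B : IsQPrincipalBundle act β) : Type u := Quotient B.gaugeSetoid

/-- The quotient map `(p, q) ↦ [p, q]` from `P × P` to `(P × P)/G`. -/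
def gaugeMk (B : IsQPrincipalBundle act β) (a : P × P) : B.GaugeSpace :=
  Quotient.mk B.gaugeSetoid a

theorem gaugeMk_surjective (B : IsQPrincipalBundle act β) : Function.Surjective B.gaugeMk := Quotient.mk_surjective

theorem gaugeMk_eq (B : IsQPrincipalBundle act β) {a b : P × P} : B.gaugeMk a = B.gaugeMk b ↔
    ∃ g, b = (act a.1 g, act a.2 g) :=
  ⟨fun h => Quotient.exact h, fun h => Quotient.sound h⟩

/-- The source map `[p, q] ↦ β q`. -/
def gaugeSrc (B : IsQPrincipalBundle act β) : B.GaugeSpace → N :=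
  Quotient.lift (fun a => β a.2) (by rintro a _ ⟨g, rfl⟩; exact (B.proj_act _ _).symm)

/-- The target map `[p, q] ↦ β p`. -/
def gaugeTgt (B : IsQPrincipalBundle act β) : B.GaugeSpace → N :=
  Quotient.lift (fun a => β a.1) (by rintro a _ ⟨g, rfl⟩; exact (B.proj_act _ _).symm)

theorem exists_gaugeMul (B : IsQPrincipalBundle act β) (a b : B.GaugeSpace) (e : B.gaugeSrc a = B.gaugeTgt b) :
    ∃ c : B.GaugeSpace, ∀ p q r, a = B.gaugeMk (p, q) → b = B.gaugeMk (q, r) →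
      c = B.gaugeMk (p, r) := by
  obtain ⟨⟨p, q⟩, rfl⟩ := B.gaugeMk_surjective a
  obtain ⟨⟨q', r⟩, rfl⟩ := B.gaugeMk_surjective b
  obtain ⟨g, rfl⟩ := B.exists_act (p := q) (q := q') e
  refine ⟨B.gaugeMk (p, act r g), fun p₁ q₁ r₁ h₁ h₂ => ?_⟩
  obtain ⟨k, hk⟩ := B.gaugeMk_eq.mp h₁
  obtain ⟨l, hl⟩ := B.gaugeMk_eq.mp h₂
  obtain ⟨rfl, hk'⟩ := Prod.mk.inj hk
  obtain ⟨hl', rfl⟩ := Prod.mk.inj hl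
  have : l = g * k := B.act_inj (p := q') (by rw [B.act_mul]; exact hl'.symm.trans hk')
  exact B.gaugeMk_eq.mpr ⟨k, by simp only [this, B.act_mul]⟩

/-- The multiplication, characterized by `[p, q][q, r] = [p, r]`. -/
noncomputable def gaugeMul (B : IsQPrincipalBundle act β) (a b : B.GaugeSpace)
    (e : B.gaugeSrc a = B.gaugeTgt b) : B.GaugeSpace :=
  (B.exists_gaugeMul a b e).choose

theorem gaugeMul_mk (B : IsQPrincipalBundle act β) (p q r : P)
    (e : B.gaugeSrc (B.gaugeMk (p, q)) = B.gaugeTgt (B.gaugeMk (q, r))) :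
    B.gaugeMul (B.gaugeMk (p, q)) (B.gaugeMk (q, r)) e = B.gaugeMk (p, r) :=
  (B.exists_gaugeMul _ _ e).choose_spec p q r rfl rfl

/-- The identity section, `1_{β p} = [p, p]`. -/
noncomputable def gaugeOne (B : IsQPrincipalBundle act β) (n : N) : B.GaugeSpace :=
  B.gaugeMk ((B.proj_surjective n).choose, (B.proj_surjective n).choose)

theorem gaugeOne_proj (B : IsQPrincipalBundle act β) (p : P) : B.gaugeOne (β p) = B.gaugeMk (p, p) := by
  obtain ⟨g, hg⟩ := B.exists_act (B.proj_surjective (β p)).choose_spec.symm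
  exact B.gaugeMk_eq.mpr ⟨g, by rw [hg]⟩

/-- The inversion, `[p, q]⁻¹ = [q, p]`. -/
def gaugeInv (B : IsQPrincipalBundle act β) : B.GaugeSpace → B.GaugeSpace :=
  Quotient.lift (fun a => B.gaugeMk (a.2, a.1)) (by
    rintro a _ ⟨g, rfl⟩
    exact B.gaugeMk_eq.mpr ⟨g, rfl⟩)

/-- Every element composable with `[p, q]` on the right can be written as `[q, r]`. -/
theorem exists_gaugeMk (B : IsQPrincipalBundle act β) (q : P) (b : B.GaugeSpace) (e : β q = B.gaugeTgt b) :
    ∃ r, b = B.gaugeMk (q, r) := by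
  obtain ⟨⟨q', r⟩, rfl⟩ := B.gaugeMk_surjective b
  obtain ⟨g, rfl⟩ := B.exists_act (p := q) (q := q') e
  exact ⟨act r g, B.gaugeMk_eq.mpr ⟨g, rfl⟩⟩

/-- The gauge groupoid `(P × P)/G` over `N`. -/
noncomputable def gaugeGroupoid (B : IsQPrincipalBundle act β) : GroupoidOver B.GaugeSpace N where
  src := B.gaugeSrc
  tgt := B.gaugeTgt
  mul := B.gaugeMul
  one := B.gaugeOne
  inv := B.gaugeInv
  src_mul a b e := by
    obtain ⟨⟨p, q⟩, rfl⟩ := B.gaugeMk_surjective a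
    obtain ⟨r, rfl⟩ := B.exists_gaugeMk q b e
    rw [B.gaugeMul_mk]
    rfl
  tgt_mul a b e := by
    obtain ⟨⟨p, q⟩, rfl⟩ := B.gaugeMk_surjective a
    obtain ⟨r, rfl⟩ := B.exists_gaugeMk q b e
    rw [B.gaugeMul_mk]
    rfl
  mul_assoc a b c e e' := by
    obtain ⟨⟨p, q⟩, rfl⟩ := B.gaugeMk_surjective a
    obtain ⟨r, rfl⟩ := B.exists_gaugeMk q b e
    obtain ⟨s, rfl⟩ := B.exists_gaugeMk r c e'
    simp only [B.gaugeMul_mk]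
  src_one n := by
    obtain ⟨p, rfl⟩ := B.proj_surjective n
    rw [B.gaugeOne_proj]
    rfl
  tgt_one n := by
    obtain ⟨p, rfl⟩ := B.proj_surjective n
    rw [B.gaugeOne_proj]
    rfl
  mul_one a := by
    obtain ⟨⟨p, q⟩, rfl⟩ := B.gaugeMk_surjective a
    have h : B.gaugeOne (B.gaugeSrc (B.gaugeMk (p, q))) = B.gaugeMk (q, q) := B.gaugeOne_proj q
    simp only [h, B.gaugeMul_mk]
  one_mul a := by
    obtain ⟨⟨p, q⟩, rfl⟩ := B.gaugeMk_surjective a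
    have h : B.gaugeOne (B.gaugeTgt (B.gaugeMk (p, q))) = B.gaugeMk (p, p) := B.gaugeOne_proj p
    simp only [h, B.gaugeMul_mk]
  src_inv a := by
    obtain ⟨⟨p, q⟩, rfl⟩ := B.gaugeMk_surjective a
    rfl
  tgt_inv a := by
    obtain ⟨⟨p, q⟩, rfl⟩ := B.gaugeMk_surjective a
    rfl
  mul_inv a := by
    obtain ⟨⟨p, q⟩, rfl⟩ := B.gaugeMk_surjective a
    exact (B.gaugeMul_mk p q p rfl).trans (B.gaugeOne_proj p).symm
  inv_mul a := by
    obtain ⟨⟨p, q⟩, rfl⟩ := B.gaugeMk_surjective a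
    exact (B.gaugeMul_mk q p q rfl).trans (B.gaugeOne_proj q).symm

/-- A Q-manifold structure on `(P × P)/G` is the one of the gauge groupoid if the quotient map
`P × P → (P × P)/G` is a Q-submersion. This determines the Q-manifold structure. -/
def IsGaugeQManifold (B : IsQPrincipalBundle act β) (Q : QManifold B.GaugeSpace) : Prop :=
  QSubmersion B.gaugeMk

end IsQPrincipalBundle

/-! An arrow k is recovered from any h in 𝒢(x,-) ending at its source, as k = (kh)h⁻¹, and two such
h differ by an element of 𝒢(x). Surjectivity of (s,t) provides such an h, so [g,h] ↦ gh⁻¹ is a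
bijection (`gaugeDiv_bijective`). The Q-manifold structure of the gauge space is transported along
it, which makes the gauge groupoid a Q-groupoid isomorphic to 𝒢 at once (`IsQGroupoid.transport`).
What remains is that 𝒢(x,-) and 𝒢(x) are immersed Q-submanifolds, that t_x is locally trivial, and
that the transported structure is the correct one, i.e. that the quotient map is a Q-submersion.

All smoothness arguments go through plots, that is, Q-smooth maps from manifolds. Transversality of
charts lets a plot lift locally through every chart with a prescribed value (`QSmooth.exists_lift`),
so a map is Q-smooth as soon as it preserves plots (`QSmooth.of_plots`). The second chart condition
makes such lifts unique as germs. Conversely, a Q-smooth map from a manifold through which plots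
lift, uniquely, is a chart (`exists_isChartOf`): lifts in the two directions are mutually inverse
germs.

A Q-submersion to a manifold looks like a linear projection on the domain of the Q-atlas. The
preimage there of a fibre is therefore an embedded submanifold, and it serves as an atlas of the
fibre (`QSubmersion.exists_fibre`); this applies to s over x and to (s,t) over (x,x). The same
projections give local sections of (s,t); restricted to {x} × N they are local sections σ of t_x,
and h ↦ (t(h), σ(t(h))⁻¹h) trivializes the bundle. Finally, over an open U where the bundle is
trivial, a pair (g,h) is determined by gh⁻¹ and the isotropy coordinate of h. In these coordinates
the quotient map is a first projection (`IsLocallyTrivial.qSubmersion_gaugeMk`). -/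

/-! ### Germs of smooth maps -/

namespace SmoothMfd

variable {M N N' T : SmoothMfd.{u}}

/-- `f` is smooth on a neighbourhood of `m`. -/
def SmoothNear (f : M → N) (m : M) : Prop :=
  ∀ᶠ z in 𝓝 m, ContMDiffAt 𝓘(ℝ, M.E) 𝓘(ℝ, N.E) ∞ f z

theorem SmoothNear.contMDiffAt {f : M → N} {m : M} (h : SmoothNear f m) :
    ContMDiffAt 𝓘(ℝ, M.E) 𝓘(ℝ, N.E) ∞ f m :=
  h.self_of_nhds

theorem SmoothNear.continuousAt {f : M → N} {m : M} (h : SmoothNear f m) : ContinuousAt f m :=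
  h.contMDiffAt.continuousAt

theorem Smooth.smoothNear {f : M → N} (h : Smooth f) (m : M) : SmoothNear f m :=
  Filter.Eventually.of_forall fun z => h z

theorem SmoothNear.comp {g : N → N'} {f : M → N} {m : M} (hg : SmoothNear g (f m))
    (hf : SmoothNear f m) : SmoothNear (g ∘ f) m := by
  filter_upwards [hf, hf.continuousAt.eventually hg] with z h1 h2
  exact h2.comp z h1

theorem SmoothNear.comp_of_eq {g : N → N'} {f : M → N} {m : M} {n : N} (hg : SmoothNear g n)
    (hf : SmoothNear f m) (e : f m = n) : SmoothNear (g ∘ f) m := by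
  subst e
  exact hg.comp hf

theorem SmoothNear.congr {f g : M → N} {m : M} (hf : SmoothNear f m) (e : f =ᶠ[𝓝 m] g) :
    SmoothNear g m := by
  filter_upwards [hf, e.eventuallyEq_nhds] with z h1 h2
  exact h1.congr_of_eventuallyEq h2.symm

theorem SmoothNear.prodMk {f : T → M} {g : T → N} {t : T} (hf : SmoothNear f t)
    (hg : SmoothNear g t) : SmoothNear (N := M.prod N) (fun z => ((f z, g z) : M × N)) t := by
  filter_upwards [hf, hg] with z h1 h2
  have := h1.prodMk h2
  rw [← modelWithCornersSelf_prod] at this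
  exact this

theorem smooth_incl (U : TopologicalSpace.Opens M) : Smooth (M.incl U) :=
  contMDiff_subtype_val (I := 𝓘(ℝ, M.E)) (U := U)

theorem smooth_id : Smooth (id : M → M) :=
  contMDiff_id

theorem continuous_incl (U : TopologicalSpace.Opens M) : Continuous (M.incl U) :=
  continuous_subtype_val

theorem eventually_incl {U : TopologicalSpace.Opens M} {m : M.restrict U} {p : M → Prop} :
    (∀ᶠ z in 𝓝 m, p (M.incl U z)) ↔ ∀ᶠ z in 𝓝 (M.incl U m), p z := by
  have h : Topology.IsOpenEmbedding (M.incl U) := U.2.isOpenEmbedding_subtypeVal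
  rw [← h.map_nhds_eq, Filter.eventually_map]

/-- A map which is smooth near `t` and has values in the open set `U` near `t`, lifted to `U`. -/
theorem SmoothNear.exists_codRestrict {f : T → M} {U : TopologicalSpace.Opens M} {t : T}
    (hf : SmoothNear f t) (ht : f t ∈ U) :
    ∃ F : T → M.restrict U, SmoothNear F t ∧ ∀ᶠ z in 𝓝 t, M.incl U (F z) = f z := by
  classical
  -- The default value `f t` only matters away from `t`: by continuity `f` stays in `U` near `t`.
  let F : T → M.restrict U := fun z => if h : f z ∈ U then (⟨f z, h⟩ : U) else (⟨f t, ht⟩ : U)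
  have hF : ∀ᶠ z in 𝓝 t, M.incl U (F z) = f z := by
    filter_upwards [hf.continuousAt.eventually (U.2.mem_nhds ht)] with z hz
    exact congrArg Subtype.val (dif_pos (show f z ∈ U from hz))
  refine ⟨F, ?_, hF⟩
  filter_upwards [hf, hF.eventually_nhds] with z h1 h2
  have h3 : ContMDiffAt 𝓘(ℝ, T.E) 𝓘(ℝ, M.E) ∞ (M.incl U ∘ F) z := h1.congr_of_eventuallyEq h2
  exact (ContMDiffAt.subtypeVal_comp_iff (I' := 𝓘(ℝ, M.E)) U F z).1 h3

theorem smooth_iff_smoothNear {f : M → N} : Smooth f ↔ ∀ m, SmoothNear f m :=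
  ⟨fun h m => h.smoothNear m, fun h m => (h m).contMDiffAt⟩

namespace LocalDiffeo

theorem smoothNear (h : LocalDiffeo M N) {m : M} (hm : m ∈ h.source) : SmoothNear h m := by
  filter_upwards [h.open_source.mem_nhds hm] with z hz
  exact h.contMDiffOn_toFun.contMDiffAt (h.open_source.mem_nhds hz)

theorem smoothNear_symm (h : LocalDiffeo M N) {n : N} (hn : n ∈ h.target) :
    SmoothNear h.symm n :=
  LocalDiffeo.smoothNear (h := h.symm) hn

end LocalDiffeo

end SmoothMfd

open SmoothMfd

/-! ### Lifting through Q-charts -/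

section Charts

variable {S S' S'' : Type u}

/-- Two lifts which agree at a point agree near that point. -/
theorem IsQChart.eventuallyEq {M T : SmoothMfd.{u}} {π : M → S} (hπ : IsQChart π) {f h : T → M}
    {t : T} (hf : SmoothNear f t) (hh : SmoothNear h t) (e : π ∘ f =ᶠ[𝓝 t] π ∘ h)
    (et : f t = h t) : f =ᶠ[𝓝 t] h := by
  obtain ⟨U, hU, hUo, ht⟩ := eventually_nhds_iff.1 (hf.and (hh.and e))
  -- The Q-chart condition speaks of globally smooth maps with equal projections, so it is applied
  -- on an open set where both germ hypotheses hold pointwise.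
  let U' : TopologicalSpace.Opens T := ⟨U, hUo⟩
  have h1 := hπ.isOpen_eqLocus (T.restrict U') (f ∘ T.incl U') (h ∘ T.incl U')
    (fun z => (hU z.1 z.2).1.comp z (smooth_incl _ z))
    (fun z => (hU z.1 z.2).2.1.comp z (smooth_incl _ z))
    (funext fun z => (hU z.1 z.2).2.2)
  have h2 : ∀ᶠ z : T.restrict U' in 𝓝 (⟨t, ht⟩ : U'), f (T.incl U' z) = h (T.incl U' z) :=
    h1.mem_nhds et
  exact (eventually_incl (p := fun z => f z = h z)).1 h2

/-- Mutually inverse smooth germs over `S` are given by a local diffeomorphism over `S`. -/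
theorem exists_localDiffeo_of_germs {M M' : SmoothMfd.{u}} {π : M → S} {π' : M' → S}
    {F : M → M'} {G : M' → M} {m : M} {m' : M'} (hF : SmoothNear F m) (hG : SmoothNear G m')
    (hm : F m = m') (hFπ : π' ∘ F =ᶠ[𝓝 m] π)
    (hGF : G ∘ F =ᶠ[𝓝 m] id) (hFG : F ∘ G =ᶠ[𝓝 m'] id) :
    ∃ h : LocalDiffeo M M', m ∈ h.source ∧ h m = m' ∧ ∀ z ∈ h.source, π' (h z) = π z := by
  obtain ⟨U, hU, hUo, hmU⟩ := eventually_nhds_iff.1 (hF.and (hFπ.and hGF))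
  obtain ⟨V, hV, hVo, hmV⟩ := eventually_nhds_iff.1 (hG.and hFG)
  have cF : ContinuousOn F U := fun z hz => (hU z hz).1.continuousAt.continuousWithinAt
  have cG : ContinuousOn G V := fun z hz => (hV z hz).1.continuousAt.continuousWithinAt
  have gf : ∀ z ∈ U, G (F z) = z := fun z hz => (hU z hz).2.2
  have fg : ∀ z ∈ V, F (G z) = z := fun z hz => (hV z hz).2
  -- On `U` one has G ∘ F = id and on `V` one has F ∘ G = id; intersecting with preimages makes each
  -- map send its domain into the other's.
  refine ⟨{ toFun := F
            invFun := G
            source := U ∩ F ⁻¹' V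
            target := V ∩ G ⁻¹' U
            map_source' := fun z hz => ⟨hz.2, by
              rw [Set.mem_preimage, gf z hz.1]; exact hz.1⟩
            map_target' := fun z hz => ⟨hz.2, by
              rw [Set.mem_preimage, fg z hz.1]; exact hz.1⟩
            left_inv' := fun z hz => gf z hz.1
            right_inv' := fun z hz => fg z hz.1
            open_source := cF.isOpen_inter_preimage hUo hVo
            open_target := cG.isOpen_inter_preimage hVo hUo
            contMDiffOn_toFun := fun z hz => (hU z hz.1).1.contMDiffWithinAt
            contMDiffOn_invFun := fun z hz => (hV z hz.1).1.contMDiffWithinAt },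
    ⟨hmU, ?_⟩, hm, fun z hz => (hU z hz.1).2.1⟩
  rw [Set.mem_preimage, hm]
  exact hmV

/-- The composites G ∘ F and F ∘ G lift the same maps as the identities and agree with them at the
base points, so uniqueness of lifts makes them identities as germs. For `π` only uniqueness of lifts
is required, since the result serves to prove that `π` is a Q-chart. -/
theorem exists_localDiffeo_of_lifts {M M' : SmoothMfd.{u}} {π : M → S} {π' : M' → S}
    (hπ : ∀ (T : SmoothMfd.{u}) (f h : T → M) (t : T), SmoothNear f t → SmoothNear h t →
      π ∘ f =ᶠ[𝓝 t] π ∘ h → f t = h t → f =ᶠ[𝓝 t] h) (hπ' : IsQChart π')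
    {F : M → M'} {G : M' → M} {m : M} {m' : M'} (hF : SmoothNear F m) (hG : SmoothNear G m')
    (hm : F m = m') (hm' : G m' = m) (hFπ : π' ∘ F =ᶠ[𝓝 m] π) (hGπ : π ∘ G =ᶠ[𝓝 m'] π') :
    ∃ h : LocalDiffeo M M', m ∈ h.source ∧ h m = m' ∧ ∀ z ∈ h.source, π' (h z) = π z := by
  refine exists_localDiffeo_of_germs hF hG hm hFπ ?_ ?_
  · refine hπ M _ _ _ (hG.comp_of_eq hF hm) (smooth_id.smoothNear m) ?_ (by simp [hm, hm'])
    have := (hm ▸ hF.continuousAt.tendsto : Filter.Tendsto F (𝓝 m) (𝓝 m')).eventually hGπ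
    filter_upwards [hFπ, this] with z h1 h2
    exact h2.trans h1
  · refine hπ'.eventuallyEq (hF.comp_of_eq hG hm') (smooth_id.smoothNear m') ?_
      (by simp [hm, hm'])
    have := (hm' ▸ hG.continuousAt.tendsto : Filter.Tendsto G (𝓝 m') (𝓝 m)).eventually hFπ
    filter_upwards [hGπ, this] with z h1 h2
    exact h2.trans h1

/-- `x` and `y` are related by a local diffeomorphism over `S`. -/
def TransverseAt {M M' : SmoothMfd.{u}} (π : M → S) (π' : M' → S) (x : M) (y : M') : Prop :=
  ∃ h : LocalDiffeo M M', x ∈ h.source ∧ h x = y ∧ ∀ z ∈ h.source, π' (h z) = π z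

namespace TransverseAt

variable {M M' M'' : SmoothMfd.{u}} {π : M → S} {π' : M' → S} {π'' : M'' → S}
  {x : M} {y : M'} {z : M''}

theorem symm (h : TransverseAt π π' x y) : TransverseAt π' π y x := by
  obtain ⟨h, hx, rfl, hh⟩ := h
  refine ⟨h.symm, h.map_source hx, h.left_inv hx, fun w hw => ?_⟩
  exact (hh _ (h.map_target hw)).symm.trans (congrArg π' (h.right_inv hw))

theorem trans (h : TransverseAt π π' x y) (k : TransverseAt π' π'' y z) :
    TransverseAt π π'' x z := by
  obtain ⟨h, hx, rfl, hh⟩ := h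
  obtain ⟨k, ky, rfl, hk⟩ := k
  exact ⟨h.trans k, ⟨hx, ky⟩, rfl, fun w hw => (hk _ hw.2).trans (hh w hw.1)⟩

theorem incl (π : M → S) (U : TopologicalSpace.Opens M) (x : M.restrict U) :
    TransverseAt (π ∘ M.incl U) π x (M.incl U x) := by
  obtain ⟨G, hG, hGe⟩ := (smooth_id.smoothNear (M.incl U x)).exists_codRestrict (U := U) x.2
  have hGx : G (M.incl U x) = x := Subtype.ext hGe.self_of_nhds
  refine exists_localDiffeo_of_germs (F := M.incl U) (G := G)
    ((smooth_incl U).smoothNear x) hG rfl (Filter.Eventually.of_forall fun _ => rfl) ?_ hGe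
  filter_upwards [(continuous_incl U).continuousAt.eventually hGe] with z hz
  exact Subtype.ext hz

end TransverseAt

/-- The restriction of a Q-chart to an open subset. -/
noncomputable def QChart.restrict (c : QChart S) (U : TopologicalSpace.Opens c.M) : QChart S where
  M := c.M.restrict U
  π := c.π ∘ c.M.incl U
  isQChart :=
    { transverse := fun x y e => (TransverseAt.incl c.π U x).trans
        (TransverseAt.trans (c.isQChart.transverse _ _ e) (TransverseAt.incl c.π U y).symm)
      isOpen_eqLocus := fun T f h hf hh e => by
        have := c.isQChart.isOpen_eqLocus T _ _ ((smooth_incl U).comp hf)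
          ((smooth_incl U).comp hh) e
        convert this using 1
        ext t
        exact Subtype.ext_iff }

theorem QManifold.isChartOf_atlas (Q : QManifold S) : Q.atlas.IsChartOf Q :=
  Q.atlas.isQChart.transverse

/-- Any two charts of a Q-manifold are related by local diffeomorphisms. -/
theorem QChart.IsChartOf.equivalent {Q : QManifold S} {c d : QChart S} (hc : c.IsChartOf Q)
    (hd : d.IsChartOf Q) : c.Equivalent d := by
  intro x y e
  obtain ⟨a, ha⟩ := Q.surjective_atlas (c.π x)
  exact TransverseAt.trans (hc x a ha.symm) (TransverseAt.symm (hd y a (e.symm.trans ha.symm)))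

theorem QChart.IsChartOf.restrict {Q : QManifold S} {c : QChart S} (hc : c.IsChartOf Q)
    (U : TopologicalSpace.Opens c.M) : (c.restrict U).IsChartOf Q := fun x y e =>
  (TransverseAt.incl c.π U x).trans (hc _ y e)

variable [Q : QManifold S] [Q' : QManifold S'] [Q'' : QManifold S'']

/-- Q-smooth maps are those which lift locally, near every point. -/
theorem QSmooth.of_germs {f : S → S'}
    (h : ∀ s, ∃ (c : QChart S) (c' : QChart S') (F : c.M → c'.M) (m : c.M),
      c.IsChartOf Q ∧ c'.IsChartOf Q' ∧ c.π m = s ∧ f ∘ c.π =ᶠ[𝓝 m] c'.π ∘ F ∧ SmoothNear F m) :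
    QSmooth f := by
  intro s
  obtain ⟨c, c', F, m, hc, hc', hm, e, hF⟩ := h s
  obtain ⟨U, hU, hUo, hmU⟩ := eventually_nhds_iff.1 (hF.and e)
  let U' : TopologicalSpace.Opens c.M := ⟨U, hUo⟩
  -- `QSmooth` asks for a lift on the whole chart domain, so the chart is shrunk to where the germ
  -- is a smooth lift.
  refine ⟨c.restrict U', c', F ∘ c.M.incl U', (⟨m, hmU⟩ : U'), hc.restrict U', hc', hm, ?_, ?_⟩
  · exact funext fun z => (hU z.1 z.2).2
  · exact fun z => (hU z.1 z.2).1.comp z (smooth_incl _ z)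

end Charts

/-! ### Q-smooth maps and plots -/

section Plots

variable {S S' S'' : Type u} [Q : QManifold S] [Q' : QManifold S'] [Q'' : QManifold S'']
  {T : SmoothMfd.{u}}

/-- A Q-smooth map from a manifold lifts locally through every chart, with prescribed value. -/
theorem QSmooth.exists_lift {p : T → S} (hp : QSmooth p) {c : QChart S} (hc : c.IsChartOf Q)
    {t : T} {m : c.M} (e : c.π m = p t) :
    ∃ F : T → c.M, SmoothNear F t ∧ F t = m ∧ c.π ∘ F =ᶠ[𝓝 t] p := by
  obtain ⟨d, d', F, x, hd, hd', hx, eF, hF⟩ := hp t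
  -- The lift given by `hp` uses unknown charts on both sides. Here `h` identifies the chart `d` of
  -- `T` with `T` itself near `t`; below, `k` passes from `d'` to `c` and moves the value `F x` to
  -- the prescribed `m`.
  obtain ⟨h, hxs, hxt, hh⟩ := hd x t hx
  have hh : ∀ z ∈ h.source, h z = d.π z := hh
  have tt : t ∈ h.target := hxt ▸ h.map_source hxs
  have htx : h.symm t = x := by rw [← hxt]; exact h.left_inv hxs
  obtain ⟨k, kx, kt, hk⟩ := hd'.equivalent hc (F x) m
    (((congrFun eF x).symm.trans (congrArg p hx)).trans e.symm)
  have hFh : SmoothNear (F ∘ h.symm) t := (hF.smoothNear x).comp_of_eq (h.smoothNear_symm tt) htx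
  have eFh : (F ∘ h.symm) t = F x := congrArg F htx
  refine ⟨k ∘ (F ∘ h.symm), (k.smoothNear kx).comp_of_eq hFh eFh,
    (congrArg k eFh).trans kt, ?_⟩
  have h1 : ∀ᶠ z in 𝓝 t, (F ∘ h.symm) z ∈ k.source :=
    hFh.continuousAt.eventually (by rw [eFh]; exact k.open_source.mem_nhds kx)
  filter_upwards [h1, h.open_target.mem_nhds tt] with z hz hz'
  refine (hk _ hz).trans ((congrFun eF (h.symm z)).symm.trans (congrArg p ?_))
  exact (hh _ (h.map_target hz')).symm.trans (h.right_inv hz')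

theorem QSmooth.of_lifts {p : T → S} (h : ∀ t, ∃ (c : QChart S) (F : T → c.M), c.IsChartOf Q ∧
    SmoothNear F t ∧ c.π ∘ F =ᶠ[𝓝 t] p) : QSmooth p := by
  refine QSmooth.of_germs fun t => ?_
  obtain ⟨c, F, hc, hF, e⟩ := h t
  exact ⟨T.instQManifold.atlas, c, F, t, T.instQManifold.isChartOf_atlas, hc, rfl, e.symm, hF⟩

theorem QChart.IsChartOf.qSmooth {c : QChart S} (hc : c.IsChartOf Q) : QSmooth c.π :=
  QSmooth.of_lifts fun t => ⟨c, id, hc, smooth_id.smoothNear t, Filter.EventuallyEq.rfl⟩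

/-- The charts in which the two maps are given need not match; lifting the plot through the source
chart of `f`, with the prescribed value `m`, makes the lifts composable. -/
theorem QSmooth.comp_plot {f : S → S'} (hf : QSmooth f) {p : T → S} (hp : QSmooth p) :
    QSmooth fun t => f (p t) := by
  refine QSmooth.of_lifts fun t => ?_
  obtain ⟨c, c', F, m, hc, hc', hm, e, hF⟩ := hf (p t)
  obtain ⟨P, hP, hPt, hPp⟩ := hp.exists_lift hc hm
  refine ⟨c', F ∘ P, hc', (hF.smoothNear m).comp_of_eq hP hPt, ?_⟩
  filter_upwards [hPp] with z hz
  exact (congrFun e (P z)).symm.trans (congrArg f hz)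

/-- A map is Q-smooth if its composition with the Q-atlas is Q-smooth. -/
theorem QSmooth.of_atlas {f : S → S'} (h : QSmooth fun a => f (Q.atlas.π a)) : QSmooth f := by
  refine QSmooth.of_germs fun s => ?_
  obtain ⟨a, rfl⟩ := Q.surjective_atlas s
  obtain ⟨b, hb⟩ := Q'.surjective_atlas (f (Q.atlas.π a))
  obtain ⟨F, hF, -, e⟩ := h.exists_lift Q'.isChartOf_atlas hb
  exact ⟨Q.atlas, Q'.atlas, F, a, Q.isChartOf_atlas, Q'.isChartOf_atlas, rfl, e.symm, hF⟩

/-- Q-smooth maps are those which preserve Q-smooth maps from manifolds. -/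
theorem QSmooth.of_plots {f : S → S'}
    (h : ∀ (T : SmoothMfd.{u}) (p : T → S), QSmooth p → QSmooth fun t => f (p t)) : QSmooth f :=
  .of_atlas (h _ _ Q.isChartOf_atlas.qSmooth)

theorem QSmooth.comp {g : S' → S''} {f : S → S'} (hg : QSmooth g) (hf : QSmooth f) :
    QSmooth fun s => g (f s) :=
  .of_plots fun _ _ hp => hg.comp_plot (hf.comp_plot hp)

theorem QSmooth.const (s : S') : QSmooth fun _ : S => s := by
  obtain ⟨a, rfl⟩ := Q'.surjective_atlas s
  exact .of_plots fun _ _ _ => .of_lifts fun _ => ⟨Q'.atlas, fun _ => a, Q'.isChartOf_atlas,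
    Filter.Eventually.of_forall fun _ => contMDiffAt_const, Filter.EventuallyEq.rfl⟩

/-- A lift through the identity chart is the map itself. -/
theorem qSmooth_iff_smooth {N : SmoothMfd.{u}} {f : T → N} : QSmooth f ↔ Smooth f := by
  refine ⟨fun h => smooth_iff_smoothNear.2 fun t => ?_, fun h => .of_lifts fun t =>
    ⟨N.instQManifold.atlas, f, N.instQManifold.isChartOf_atlas, h.smoothNear t,
      Filter.EventuallyEq.rfl⟩⟩
  obtain ⟨F, hF, -, e⟩ := h.exists_lift N.instQManifold.isChartOf_atlas (m := f t) rfl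
  exact hF.congr e

theorem QSmooth.prodMk_plot {p : T → S} {q : T → S'} (hp : QSmooth p) (hq : QSmooth q) :
    QSmooth fun t => (p t, q t) := by
  refine .of_lifts fun t => ?_
  obtain ⟨a, ha⟩ := Q.surjective_atlas (p t)
  obtain ⟨b, hb⟩ := Q'.surjective_atlas (q t)
  obtain ⟨F, hF, -, eF⟩ := hp.exists_lift Q.isChartOf_atlas ha
  obtain ⟨G, hG, -, eG⟩ := hq.exists_lift Q'.isChartOf_atlas hb
  exact ⟨QManifold.instProd.atlas, fun z => (F z, G z), QManifold.instProd.isChartOf_atlas,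
    hF.prodMk hG, eF.prodMk eG⟩

theorem QSmooth.fst : QSmooth fun p : S × S' => p.1 :=
  .of_atlas <| .of_lifts fun _ => ⟨Q.atlas, Prod.fst, Q.isChartOf_atlas,
    (smooth_fst _ _).smoothNear _, Filter.EventuallyEq.rfl⟩

theorem QSmooth.snd : QSmooth fun p : S × S' => p.2 :=
  .of_atlas <| .of_lifts fun _ => ⟨Q'.atlas, Prod.snd, Q'.isChartOf_atlas,
    (smooth_snd _ _).smoothNear _, Filter.EventuallyEq.rfl⟩

theorem QSmooth.prodMk {f : S → S'} {g : S → S''} (hf : QSmooth f) (hg : QSmooth g) :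
    QSmooth fun s => (f s, g s) :=
  .of_plots fun _ _ hp => (hf.comp_plot hp).prodMk_plot (hg.comp_plot hp)

/-! ### Construction of Q-charts -/

/-- The second condition in the definition of a Q-chart, for germs. -/
def HasUniqueLifts {W : SmoothMfd.{u}} (w : W → S) : Prop :=
  ∀ (T : SmoothMfd.{u}) (f h : T → W) (t : T), SmoothNear f t → SmoothNear h t →
    w ∘ f =ᶠ[𝓝 t] w ∘ h → f t = h t → f =ᶠ[𝓝 t] h

omit Q in
theorem HasUniqueLifts.isOpen {W : SmoothMfd.{u}} {w : W → S} (hw : HasUniqueLifts w)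
    (T : SmoothMfd.{u}) (f h : T → W) (hf : Smooth f) (hh : Smooth h) (e : w ∘ f = w ∘ h) :
    IsOpen {t | f t = h t} :=
  isOpen_iff_mem_nhds.2 fun t ht =>
    hw T f h t (hf.smoothNear t) (hh.smoothNear t) (e ▸ Filter.EventuallyEq.rfl) ht

/-- A Q-smooth map with unique lifts, through which all Q-smooth maps lift, is a chart. -/
theorem exists_isChartOf {W : SmoothMfd.{u}} {w : W → S} (hs : QSmooth w) (hw : HasUniqueLifts w)
    (lift : ∀ (T : SmoothMfd.{u}) (p : T → S) (t : T) (y : W), QSmooth p → w y = p t →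
      ∃ F : T → W, SmoothNear F t ∧ F t = y ∧ w ∘ F =ᶠ[𝓝 t] p) :
    ∃ h : IsQChart w, QChart.IsChartOf ⟨W, w, h⟩ Q := by
  -- Lift `w` through the atlas and the atlas through `w`: the two germs are mutually inverse.
  -- Transversality of `w` with itself then follows by passing through a point of the atlas.
  have key : ∀ (y : W) (a : Q.atlas.M), w y = Q.atlas.π a → TransverseAt w Q.atlas.π y a := by
    intro y a e
    obtain ⟨F, hF, eF, hFw⟩ := hs.exists_lift Q.isChartOf_atlas e.symm
    obtain ⟨G, hG, eG, hGw⟩ := lift _ _ a y Q.isChartOf_atlas.qSmooth e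
    exact exists_localDiffeo_of_lifts hw Q.atlas.isQChart hF hG eF eG hFw hGw
  refine ⟨⟨fun x y e => ?_, hw.isOpen⟩, key⟩
  obtain ⟨a, ha⟩ := Q.surjective_atlas (w x)
  exact (key x a ha.symm).trans (key y a (e.symm.trans ha.symm)).symm

omit Q in
/-- A map from a manifold onto a set through which sufficiently many maps lift is a Q-atlas. -/
theorem IsQChart.of_lifts {W : SmoothMfd.{u}} {w : W → S} (hw : HasUniqueLifts w)
    (lift : ∀ (x y : W), w x = w y → ∃ F : W → W, SmoothNear F x ∧ F x = y ∧ w ∘ F =ᶠ[𝓝 x] w) :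
    IsQChart w := by
  refine ⟨fun x y e => ?_, hw.isOpen⟩
  obtain ⟨F, hF, eF, hFw⟩ := lift x y e
  obtain ⟨G, hG, eG, hGw⟩ := lift y x e.symm
  have hF' : Filter.Tendsto F (𝓝 x) (𝓝 y) := eF ▸ hF.continuousAt.tendsto
  have hG' : Filter.Tendsto G (𝓝 y) (𝓝 x) := eG ▸ hG.continuousAt.tendsto
  refine exists_localDiffeo_of_germs hF hG eF hFw ?_ ?_
  · refine hw _ _ _ _ (hG.comp_of_eq hF eF) (smooth_id.smoothNear x) ?_ (by simp [eF, eG])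
    filter_upwards [hFw, hF'.eventually hGw] with z h1 h2 using h2.trans h1
  · refine hw _ _ _ _ (hF.comp_of_eq hG eG) (smooth_id.smoothNear y) ?_ (by simp [eF, eG])
    filter_upwards [hGw, hG'.eventually hFw] with z h1 h2 using h2.trans h1

/-! ### Transport of Q-manifold structures -/

omit Q in
/-- The Q-chart of `S` corresponding to a Q-chart of `S'` under a bijection. -/
def QChart.transport (e : S ≃ S') (c : QChart S') : QChart S where
  M := c.M
  π := e.symm ∘ c.π
  isQChart :=
    { transverse := fun x y h => by
        obtain ⟨k, hx, hy, hk⟩ := c.isQChart.transverse x y (e.symm.injective h)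
        exact ⟨k, hx, hy, fun z hz => congrArg e.symm (hk z hz)⟩
      isOpen_eqLocus := fun T f h hf hh hfh => c.isQChart.isOpen_eqLocus T f h hf hh
        (funext fun t => e.symm.injective (congrFun hfh t)) }

omit Q in
/-- The Q-manifold structure on `S` corresponding to that of `S'` under a bijection. -/
abbrev QManifold.transport (e : S ≃ S') (Q' : QManifold S') : QManifold S where
  atlas := Q'.atlas.transport e
  surjective_atlas := e.symm.surjective.comp Q'.surjective_atlas

omit Q Q' in
theorem QChart.IsChartOf.transport {Q' : QManifold S'} (e : S ≃ S') {c : QChart S'}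
    (hc : c.IsChartOf Q') : (c.transport e).IsChartOf (Q'.transport e) := fun x y h => by
  obtain ⟨k, hx, hy, hk⟩ := hc x y (e.symm.injective h)
  exact ⟨k, hx, hy, fun z hz => congrArg e.symm (hk z hz)⟩

omit Q in
theorem qSmooth_transport (e : S ≃ S') : letI := Q'.transport e; QSmooth e := by
  let := Q'.transport e
  refine .of_atlas ?_
  have : (fun a => e ((Q'.transport e).atlas.π a)) = Q'.atlas.π :=
    funext fun a => e.apply_symm_apply _
  rw [this]
  exact Q'.isChartOf_atlas.qSmooth

omit Q in
theorem qSmooth_transport_symm (e : S ≃ S') : letI := Q'.transport e; QSmooth e.symm := by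
  let := Q'.transport e
  exact .of_atlas (Q'.transport e).isChartOf_atlas.qSmooth

end Plots

/-! ### Partial diffeomorphisms -/

section PartialDiffeo

variable {E E' H H' M M' : Type*} [NormedAddCommGroup E] [NormedSpace ℝ E]
  [NormedAddCommGroup E'] [NormedSpace ℝ E'] [TopologicalSpace H] [TopologicalSpace H']
  {I : ModelWithCorners ℝ E H} {I' : ModelWithCorners ℝ E' H'} [TopologicalSpace M]
  [TopologicalSpace M'] [ChartedSpace H M] [ChartedSpace H' M']

/-- The restriction of a partial diffeomorphism to an open set. -/
noncomputable def PartialDiffeomorph.restrOpen (Φ : PartialDiffeomorph I I' M M' ∞) (U : Set M)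
    (hU : IsOpen U) : PartialDiffeomorph I I' M M' ∞ where
  __ := Φ.toOpenPartialHomeomorph.restrOpen U hU
  contMDiffOn_toFun := Φ.contMDiffOn_toFun.mono Set.inter_subset_left
  contMDiffOn_invFun := Φ.contMDiffOn_invFun.mono Set.inter_subset_left

/-- A chart of the maximal atlas, as a partial diffeomorphism. -/
noncomputable def OpenPartialHomeomorph.toPartialDiffeomorph [IsManifold I ∞ M] (e : OpenPartialHomeomorph M H)
    (he : e ∈ IsManifold.maximalAtlas I ∞ M) : PartialDiffeomorph I I M H ∞ where
  __ := e
  contMDiffOn_toFun := contMDiffOn_of_mem_maximalAtlas he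
  contMDiffOn_invFun := contMDiffOn_symm_of_mem_maximalAtlas he

end PartialDiffeo

/-- The model spaces of diffeomorphic nonempty manifolds are isomorphic. -/
theorem PartialDiffeomorph.nonempty_linearEquiv {E E' M M' : Type*} [NormedAddCommGroup E]
    [NormedSpace ℝ E] [NormedAddCommGroup E'] [NormedSpace ℝ E'] [TopologicalSpace M]
    [TopologicalSpace M'] [ChartedSpace E M] [ChartedSpace E' M']
    (Φ : PartialDiffeomorph 𝓘(ℝ, E) 𝓘(ℝ, E') M M' ∞) {x : M} (hx : x ∈ Φ.source) :
    Nonempty (E ≃L[ℝ] E') :=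
  ⟨(Φ.isLocalDiffeomorphAt _ _ _ hx).mfderivToContinuousLinearEquiv (by simp)⟩

/-! ### Submanifolds -/

section Submanifold

variable {A : SmoothMfd.{u}} {V : Set A} {H K : Type} [NormedAddCommGroup H] [NormedSpace ℝ H]
  [NormedAddCommGroup K] [NormedSpace ℝ K]

open Classical in
/-- The chart of a subset `V` induced by a diffeomorphism which straightens `V`. -/
noncomputable def sliceChart (Θ : PartialDiffeomorph 𝓘(ℝ, A.E) 𝓘(ℝ, H × K) A (H × K) ∞)
    (hΘ : ∀ z ∈ Θ.source, z ∈ V ↔ (Θ z).1 = 0) (v : V) : OpenPartialHomeomorph V K :=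
  have key : ∀ y : K, (0, y) ∈ Θ.target → Θ.symm (0, y) ∈ V := fun y hy =>
    (hΘ _ (Θ.map_target hy)).2 (congrArg Prod.fst (Θ.right_inv hy))
  have c : ContinuousOn (fun y : K => Θ.symm ((0 : H), y)) {y | ((0 : H), y) ∈ Θ.target} :=
    Θ.contMDiffOn_invFun.continuousOn.comp (by fun_prop) fun y hy => hy
  { toFun := fun z => (Θ z).2
    invFun := fun y => if h : Θ.symm (0, y) ∈ V then ⟨Θ.symm (0, y), h⟩ else v
    source := {z | (z : A) ∈ Θ.source}
    target := {y | (0, y) ∈ Θ.target}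
    map_source' := fun z hz => by
      have h0 := (hΘ z hz).1 z.2
      show (0, (Θ z).2) ∈ Θ.target
      rw [← h0]
      exact Θ.map_source hz
    map_target' := fun y hy => by
      rw [dif_pos (key y hy)]
      exact Θ.map_target hy
    left_inv' := fun z hz => by
      have h0 : ((0 : H), (Θ z).2) = Θ z := Prod.ext ((hΘ z hz).1 z.2).symm rfl
      have h1 : Θ.symm ((0 : H), (Θ z).2) = z := by rw [h0]; exact Θ.left_inv hz
      have h2 : Θ.symm ((0 : H), (Θ z).2) ∈ V := by rw [h1]; exact z.2
      rw [dif_pos h2]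
      exact Subtype.ext h1
    right_inv' := fun y hy => by
      rw [dif_pos (key y hy)]
      exact congrArg Prod.snd (Θ.right_inv hy)
    open_source := Θ.open_source.preimage continuous_subtype_val
    open_target := Θ.open_target.preimage (by fun_prop)
    continuousOn_toFun := continuous_snd.comp_continuousOn
      (Θ.contMDiffOn_toFun.continuousOn.comp continuous_subtype_val.continuousOn fun z hz => hz)
    continuousOn_invFun := by
      rw [Topology.IsInducing.subtypeVal.continuousOn_iff]
      refine c.congr fun y hy => ?_
      rw [Function.comp_apply, dif_pos (key y hy)] }

theorem sliceChart_symm (Θ : PartialDiffeomorph 𝓘(ℝ, A.E) 𝓘(ℝ, H × K) A (H × K) ∞)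
    (hΘ : ∀ z ∈ Θ.source, z ∈ V ↔ (Θ z).1 = 0) (v : V) {y : K} (hy : (0, y) ∈ Θ.target) :
    ((sliceChart Θ hΘ v).symm y : A) = Θ.symm (0, y) := by
  have key : Θ.symm (0, y) ∈ V :=
    (hΘ _ (Θ.map_target hy)).2 (congrArg Prod.fst (Θ.right_inv hy))
  exact congrArg Subtype.val (dif_pos key)

/-- A subset of a manifold which can be straightened near each of its points is a submanifold. -/
theorem exists_submanifold [FiniteDimensional ℝ K]
    (hV : ∀ a : V, ∃ Θ : PartialDiffeomorph 𝓘(ℝ, A.E) 𝓘(ℝ, H × K) A (H × K) ∞,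
      (a : A) ∈ Θ.source ∧ ∀ z ∈ Θ.source, z ∈ V ↔ (Θ z).1 = 0) :
    ∃ (W : SmoothMfd.{u}) (ι : W → A), Topology.IsInducing ι ∧ Function.Injective ι ∧
      Set.range ι = V ∧ ∀ w, Manifold.IsImmersionAt 𝓘(ℝ, W.E) 𝓘(ℝ, A.E) ∞ ι w := by
  choose Θ hΘ hΘV using hV
  let e : V → OpenPartialHomeomorph V K := fun v => sliceChart (Θ v) (hΘV v) v
  let cs : ChartedSpace K V :=
    { atlas := Set.range e
      chartAt := e
      mem_chart_source := fun v => hΘ v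
      chart_mem_atlas := fun v => ⟨v, rfl⟩ }
  have : IsManifold 𝓘(ℝ, K) ∞ V := by
    refine isManifold_of_contDiffOn _ _ _ ?_
    rintro _ _ ⟨v, rfl⟩ ⟨w, rfl⟩
    -- The change of charts is y ↦ (Θ_w(Θ_v⁻¹(0, y))).2, a composite of maps smooth on the ambient
    -- manifold and on vector spaces.
    have h1 : ContMDiffOn 𝓘(ℝ, H × K) 𝓘(ℝ, A.E) ∞ (Θ v).symm (Θ v).target :=
      (Θ v).contMDiffOn_invFun
    have h2 : ContMDiffOn 𝓘(ℝ, A.E) 𝓘(ℝ, H × K) ∞ (Θ w) (Θ w).source :=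
      (Θ w).contMDiffOn_toFun
    have h3 : ContDiff ℝ ∞ (fun y : K => ((0 : H), y)) := by fun_prop
    have h4 : ContDiff ℝ ∞ (Prod.snd : H × K → K) := by fun_prop
    have h5 := h4.contMDiff.comp_contMDiffOn ((h2.comp' h1).comp' (h3.contMDiff.contMDiffOn (s := Set.univ)))
    simp only [modelWithCornersSelf_coe, modelWithCornersSelf_coe_symm, Set.range_id,
      Set.inter_univ, Set.preimage_id, Function.id_comp, Function.comp_id]
    rw [← contMDiffOn_iff_contDiffOn]
    refine (h5.mono ?_).congr ?_
    · rintro y ⟨hy, hy'⟩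
      refine ⟨Set.mem_univ _, hy, ?_⟩
      have hy' : ((e v).symm y : A) ∈ (Θ w).source := hy'
      rwa [sliceChart_symm _ _ _ hy] at hy'
    · rintro y ⟨hy, hy'⟩
      show (Θ w ((e v).symm y)).2 = _
      rw [sliceChart_symm _ _ _ hy]
      rfl
  refine ⟨{ E := K, carrier := V }, Subtype.val, Topology.IsInducing.subtypeVal,
    Subtype.val_injective, Subtype.range_coe, fun v => ?_⟩
  -- A chart of `A` must take values in `A.E`, so `Θ v` is followed by a linear isomorphism from `H
  -- × K` to `A.E`; the inclusion then reads y ↦ L⁻¹(0, y).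
  obtain ⟨L⟩ := (Θ v).nonempty_linearEquiv (hΘ v)
  let Ψ : PartialDiffeomorph 𝓘(ℝ, A.E) 𝓘(ℝ, A.E) A A.E ∞ :=
    (Θ v).trans L.symm.toDiffeomorph.toPartialDiffeomorph
  refine Manifold.IsImmersionAt.mk_of_charts ((ContinuousLinearEquiv.prodComm ℝ K H).trans L.symm)
    (e v) Ψ.toOpenPartialHomeomorph (hΘ v) ⟨hΘ v, trivial⟩
    (IsManifold.subset_maximalAtlas ⟨v, rfl⟩)
    (Ψ.toOpenPartialHomeomorph.mem_maximalAtlas_of_contMDiffOn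
      Ψ.contMDiffOn_toFun Ψ.contMDiffOn_invFun) (fun z hz => ⟨hz, trivial⟩) ?_
  intro y hy
  have hy : y ∈ (e v).target := by simpa using hy
  have hy : ((0 : H), y) ∈ (Θ v).target := hy
  show L.symm (Θ v ((e v).symm y)) = L.symm ((0 : H), y)
  rw [sliceChart_symm _ _ _ hy]
  exact congrArg L.symm ((Θ v).right_inv hy)

end Submanifold

/-! ### Fibres of Q-submersions -/

section Fibres

variable {S : Type u} [Q : QManifold S] {N : SmoothMfd.{u}} {f : S → N}

/-- Near every point of the Q-atlas, a Q-submersion is a projection. -/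
theorem QSubmersion.exists_projection (hf : QSubmersion f) (a : Q.atlas.M) :
    ∃ (B F : Type) (_ : NormedAddCommGroup B) (_ : NormedSpace ℝ B) (_ : NormedAddCommGroup F)
      (_ : NormedSpace ℝ F)
      (Φ : PartialDiffeomorph 𝓘(ℝ, Q.atlas.M.E) 𝓘(ℝ, B × F) Q.atlas.M (B × F) ∞)
      (ψ : PartialDiffeomorph 𝓘(ℝ, N.E) 𝓘(ℝ, B) N B ∞), a ∈ Φ.source ∧
      ∀ z ∈ Φ.source, f (Q.atlas.π z) ∈ ψ.source ∧ (Φ z).1 = ψ (f (Q.atlas.π z)) := by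
  obtain ⟨c, c', F, m, hc, hc', hm, e, hF, hs⟩ := hf (Q.atlas.π a)
  obtain ⟨h, ha, ham, hh⟩ := Q.isChartOf_atlas.equivalent hc a m hm.symm
  obtain ⟨k, km, -, hk⟩ := hc' (F m) (f (Q.atlas.π a)) ((congrFun e m).symm.trans (congrArg f hm))
  have hk : ∀ z ∈ k.source, k z = c'.π z := hk
  let D := hs.domChart.toPartialDiffeomorph hs.domChart_mem_maximalAtlas
  let C := hs.codChart.toPartialDiffeomorph hs.codChart_mem_maximalAtlas
  -- Pass from the atlas to the chart `c`, cut down to the points where `F` lands in the domain of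
  -- `k`, then use the charts straightening `F`.
  let Φ := ((h.trans (PartialDiffeomorph.restrOpen D _
      (k.open_source.preimage hF.continuous))).trans
        hs.equiv.toDiffeomorph.toPartialDiffeomorph)
  refine ⟨c'.M.E, hs.complement, inferInstance, inferInstance, inferInstance, inferInstance,
    Φ, k.symm.trans C, ?_, ?_⟩
  · refine ⟨⟨ha, ?_, ?_⟩, trivial⟩
    · show h a ∈ hs.domChart.source
      rw [ham]
      exact hs.mem_domChart_source
    · show F (h a) ∈ k.source
      rw [ham]
      exact km
  · rintro z ⟨⟨hz, hzD, hzk⟩, -⟩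
    have hzD : h z ∈ hs.domChart.source := hzD
    have hzk : F (h z) ∈ k.source := hzk
    have e1 : f (Q.atlas.π z) = k (F (h z)) := by
      rw [hk _ hzk]
      exact (congrArg f (hh z hz).symm).trans (congrFun e (h z))
    have e2 : k.symm (f (Q.atlas.π z)) = F (h z) := by
      rw [e1]
      exact k.left_inv hzk
    refine ⟨⟨?_, ?_⟩, ?_⟩
    · show f (Q.atlas.π z) ∈ k.target
      rw [e1]
      exact k.map_source hzk
    · show k.symm (f (Q.atlas.π z)) ∈ hs.codChart.source
      rw [e2]
      exact hs.source_subset_preimage_source hzD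
    · show (hs.equiv (hs.domChart (h z))).1 = hs.codChart (k.symm (f (Q.atlas.π z)))
      rw [e2]
      have hzt : hs.domChart (h z) ∈ (hs.domChart.extend 𝓘(ℝ, c.M.E)).target := by
        simpa using hs.domChart.map_source hzD
      have := hs.writtenInCharts hzt
      simp only [Function.comp_apply, mfld_simps] at this
      rw [hs.domChart.left_inv hzD] at this
      exact this.symm

/-- A Q-submersion has smooth local sections, with values in the Q-atlas, through every point. -/
theorem QSubmersion.exists_section (hf : QSubmersion f) (a : Q.atlas.M) :
    ∃ σ : N → Q.atlas.M, SmoothNear σ (f (Q.atlas.π a)) ∧ σ (f (Q.atlas.π a)) = a ∧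
      ∀ᶠ n in 𝓝 (f (Q.atlas.π a)), f (Q.atlas.π (σ n)) = n := by
  obtain ⟨B, F, _, _, _, _, Φ, ψ, ha, hΦ⟩ := hf.exists_projection a
  -- In straightened coordinates, the section keeps the fibre coordinate of `a` constant.
  let j : N → B × F := fun n => (ψ n, (Φ a).2)
  let U : Set N := ψ.source ∩ j ⁻¹' Φ.target
  have hj : ContMDiffOn 𝓘(ℝ, N.E) 𝓘(ℝ, B × F) ∞ j ψ.source := by
    have := ψ.contMDiffOn_toFun.prodMk_space (contMDiffOn_const (c := (Φ a).2))
    exact this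
  have hU : IsOpen U := hj.continuousOn.isOpen_inter_preimage ψ.open_source Φ.open_target
  have ja : j (f (Q.atlas.π a)) = Φ a := Prod.ext (hΦ a ha).2.symm rfl
  have hn : f (Q.atlas.π a) ∈ U := ⟨(hΦ a ha).1, by
    rw [Set.mem_preimage, ja]; exact Φ.map_source ha⟩
  refine ⟨fun n => Φ.symm (j n), ?_, ?_, ?_⟩
  · filter_upwards [hU.mem_nhds hn] with n hn'
    have h1 : ContMDiffOn 𝓘(ℝ, N.E) 𝓘(ℝ, Q.atlas.M.E) ∞ (Φ.symm ∘ j) U :=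
      ContMDiffOn.comp (t := Φ.target) Φ.contMDiffOn_invFun (hj.mono Set.inter_subset_left)
        Set.inter_subset_right
    exact h1.contMDiffAt (hU.mem_nhds hn')
  · show Φ.symm (j (f (Q.atlas.π a))) = a
    rw [ja]
    exact Φ.left_inv ha
  · filter_upwards [hU.mem_nhds hn] with n hn'
    have h1 := hΦ _ (Φ.map_target hn'.2)
    refine ψ.injOn h1.1 hn'.1 ?_
    exact h1.2.symm.trans (congrArg Prod.fst (Φ.right_inv hn'.2))

/-- The fibres of a Q-submersion to a manifold are immersed Q-submanifolds. -/
theorem QSubmersion.exists_fibre (hf : QSubmersion f) (n : N) (V : Set S)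
    (hV : ∀ s, s ∈ V ↔ f s = n) : ∃ QV : QManifold V, IsImmersedQSubmanifold V QV := by
  -- A manifold needs one model space, whereas the complement `F` of a local projection depends on
  -- the point. Its dimension is always `k`; at a point of the fibre the subtraction is not
  -- truncated, and with no such point `k` is irrelevant.
  let k := Module.finrank ℝ Q.atlas.M.E - Module.finrank ℝ N.E
  obtain ⟨W, ι, hι, ιinj, ιV, him⟩ : ∃ (W : SmoothMfd.{u}) (ι : W → Q.atlas.M),
      Topology.IsInducing ι ∧ Function.Injective ι ∧ Set.range ι = Q.atlas.π ⁻¹' V ∧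
        ∀ w, Manifold.IsImmersionAt 𝓘(ℝ, W.E) 𝓘(ℝ, Q.atlas.M.E) ∞ ι w := by
    refine exists_submanifold (H := N.E) (K := EuclideanSpace ℝ (Fin k)) fun ⟨a, ha⟩ => ?_
    obtain ⟨B, F, _, _, _, _, Φ, ψ, haΦ, hΦ⟩ := hf.exists_projection a
    obtain ⟨LΦ⟩ := Φ.nonempty_linearEquiv haΦ
    obtain ⟨Lψ⟩ := ψ.nonempty_linearEquiv (hΦ a haΦ).1
    have : FiniteDimensional ℝ (B × F) := LΦ.toLinearEquiv.finiteDimensional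
    have : FiniteDimensional ℝ B := Lψ.toLinearEquiv.finiteDimensional
    have : FiniteDimensional ℝ F :=
      FiniteDimensional.of_surjective (LinearMap.snd ℝ B F) LinearMap.snd_surjective
    have dim : Module.finrank ℝ F = Module.finrank ℝ (EuclideanSpace ℝ (Fin k)) := by
      have h1 := LΦ.toLinearEquiv.finrank_eq
      have h2 := Lψ.toLinearEquiv.finrank_eq
      rw [Module.finrank_prod] at h1
      rw [finrank_euclideanSpace_fin]
      omega
    let LF := ContinuousLinearEquiv.ofFinrankEq dim
    -- Translation by -ψ(n), so that the fibre becomes the zero set of the first coordinate.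
    let τ : Diffeomorph 𝓘(ℝ, B × F) 𝓘(ℝ, B × F) (B × F) (B × F) ∞ :=
      { toFun := fun z => z - (ψ n, 0)
        invFun := fun z => z + (ψ n, 0)
        left_inv := fun z => sub_add_cancel _ _
        right_inv := fun z => add_sub_cancel_right _ _
        contMDiff_toFun := (contDiff_id.sub contDiff_const).contMDiff
        contMDiff_invFun := (contDiff_id.add contDiff_const).contMDiff }
    refine ⟨(Φ.trans τ.toPartialDiffeomorph).trans
      (Lψ.symm.prodCongr LF).toDiffeomorph.toPartialDiffeomorph, ⟨⟨haΦ, trivial⟩, trivial⟩, ?_⟩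
    rintro z ⟨⟨hz, -⟩, -⟩
    have hz : z ∈ Φ.source := hz
    show Q.atlas.π z ∈ V ↔ Lψ.symm ((Φ z).1 - ψ n) = 0
    rw [hV, map_eq_zero_iff _ Lψ.symm.injective, sub_eq_zero, (hΦ z hz).2]
    have hn : n ∈ ψ.source := (hV _).1 ha ▸ (hΦ a haΦ).1
    exact (ψ.injOn.eq_iff (hΦ z hz).1 hn).symm
  have ιs : Smooth ι := fun w => (him w).contMDiffAt
  have ιmem : ∀ w, Q.atlas.π (ι w) ∈ V := fun w => by
    have : ι w ∈ Q.atlas.π ⁻¹' V := ιV ▸ Set.mem_range_self w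
    exact this
  let w : W → V := fun y => ⟨Q.atlas.π (ι y), ιmem y⟩
  have hw : HasUniqueLifts w := by
    intro T g h t hg hh e et
    have ιg := ((ιs.smoothNear _).comp hg)
    have ιh := ((ιs.smoothNear _).comp hh)
    filter_upwards [Q.atlas.isQChart.eventuallyEq ιg ιh
      (e.mono fun z hz => congrArg Subtype.val hz) (congrArg ι et)] with z hz using ιinj hz
  have lift : ∀ (T : SmoothMfd.{u}) (p : T → V) (t : T) (y : W), QSmooth (fun z => (p z : S)) →
      w y = p t → ∃ F : T → W, SmoothNear F t ∧ F t = y ∧ w ∘ F =ᶠ[𝓝 t] p := by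
    intro T p t y hp e
    obtain ⟨P, hP, hPt, eP⟩ := hp.exists_lift Q.isChartOf_atlas (m := ι y) (congrArg Subtype.val e)
    classical
    have hPV : ∀ᶠ z in 𝓝 t, ∃ x, ι x = P z := by
      filter_upwards [eP] with z hz
      have : P z ∈ Q.atlas.π ⁻¹' V := by
        show Q.atlas.π (P z) ∈ V
        rw [show Q.atlas.π (P z) = p z from hz]
        exact (p z).2
      rwa [← ιV] at this
    -- Near `t` the lift `P` of the plot stays in the range of `ι`, so the default `y` does not
    -- affect the germ.
    let F : T → W := fun z => if h : ∃ x, ι x = P z then h.choose else y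
    have hF : ∀ᶠ z in 𝓝 t, ι (F z) = P z := by
      filter_upwards [hPV] with z hz
      simp only [F]
      rw [dif_pos hz]
      exact hz.choose_spec
    refine ⟨F, ?_, ιinj (hF.self_of_nhds.trans hPt), ?_⟩
    · filter_upwards [hP, hF.eventually_nhds] with z hz hz'
      have h1 : ContMDiffAt 𝓘(ℝ, T.E) 𝓘(ℝ, Q.atlas.M.E) ∞ (ι ∘ F) z :=
        hz.congr_of_eventuallyEq hz'
      -- Smoothness descends through an immersion once `F` is continuous, and continuity holds
      -- because `ι` is inducing.
      exact (ContMDiffAt.iff_comp_isImmersionAt (him (F z))).2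
        ⟨hι.continuousAt_iff.2 h1.continuousAt, h1⟩
    · filter_upwards [hF, eP] with z h1 h2
      refine Subtype.ext ?_
      show Q.atlas.π (ι (F z)) = p z
      rw [h1]
      exact h2
  have ws : QSmooth fun y => (w y : S) := Q.isChartOf_atlas.qSmooth.comp_plot
    (qSmooth_iff_smooth.2 ιs)
  -- Since `w` is itself a plot of the ambient space, it lifts through itself between any two points
  -- of the same fibre; this is the transversality needed for an atlas.
  let QV : QManifold V :=
    { atlas := ⟨W, w, .of_lifts hw fun x y e => lift W w x y ws e.symm⟩
      surjective_atlas := by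
        rintro ⟨s, hs⟩
        obtain ⟨a, rfl⟩ := Q.surjective_atlas s
        have : a ∈ Set.range ι := ιV ▸ hs
        obtain ⟨y, rfl⟩ := this
        exact ⟨y, rfl⟩ }
  refine ⟨QV, fun s => ?_, fun T p hp hps => ?_⟩
  · obtain ⟨y, rfl⟩ := QV.surjective_atlas s
    exact ⟨QV.atlas, Q.atlas, ι, y, QV.isChartOf_atlas, Q.isChartOf_atlas, rfl, rfl, ιs, him y⟩
  · refine .of_lifts fun t => ?_
    obtain ⟨y, hy⟩ := QV.surjective_atlas ⟨p t, hp t⟩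
    obtain ⟨F, hF, -, e⟩ := lift T (fun z => ⟨p z, hp z⟩) t y hps hy
    exact ⟨QV.atlas, F, QV.isChartOf_atlas, hF, e⟩

end Fibres

/-! ### Immersed Q-submanifolds -/

section Immersed

variable {S S' : Type u} [Q : QManifold S] [Q' : QManifold S'] {V : Set S} [QV : QManifold V]

theorem IsImmersedQSubmanifold.qSmooth_val (h : IsImmersedQSubmanifold V QV) :
    QSmooth (Subtype.val : V → S) := fun s => by
  obtain ⟨c, c', F, m, hc, hc', hm, e, hF, -⟩ := h.immersion s
  exact ⟨c, c', F, m, hc, hc', hm, e, hF⟩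

/-- Maps into an immersed Q-submanifold are Q-smooth if they are Q-smooth into the ambient space. -/
theorem IsImmersedQSubmanifold.qSmooth_of_val (h : IsImmersedQSubmanifold V QV) {f : S' → V}
    (hf : QSmooth fun s => (f s : S)) : QSmooth f :=
  .of_plots fun T p hp => h.initial T (fun t => f (p t)) (fun t => (f (p t)).2) (hf.comp_plot hp)

theorem QSmooth.codRestrict {T N : SmoothMfd.{u}} {U : TopologicalSpace.Opens N}
    {f : T → N.restrict U} (hf : QSmooth fun t => N.incl U (f t)) : QSmooth f :=
  qSmooth_iff_smooth.2 fun t => (ContMDiffAt.subtypeVal_comp_iff (I' := 𝓘(ℝ, N.E)) U f t).1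
    (qSmooth_iff_smooth.1 hf t)

theorem SmoothMfd.qSmooth_incl {N : SmoothMfd.{u}} (U : TopologicalSpace.Opens N) :
    QSmooth (N.incl U) :=
  qSmooth_iff_smooth.2 (smooth_incl U)

theorem QSmooth.continuous {T N : SmoothMfd.{u}} {f : T → N} (hf : QSmooth f) : Continuous f :=
  (qSmooth_iff_smooth.1 hf).continuous

omit Q in
/-- A lift defined on an open neighbourhood of `t` extends, near `t`, to a lift on `T`. -/
theorem SmoothMfd.exists_extend_lift {T W : SmoothMfd.{u}} {U : TopologicalSpace.Opens T}
    {t : T.restrict U} {w : W → S} {p : T → S} {F : T.restrict U → W} (hF : SmoothNear F t)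
    (e : w ∘ F =ᶠ[𝓝 t] p ∘ T.incl U) :
    ∃ F' : T → W, SmoothNear F' (T.incl U t) ∧ F' (T.incl U t) = F t ∧
      w ∘ F' =ᶠ[𝓝 (T.incl U t)] p := by
  obtain ⟨G, hG, hGe⟩ := (smooth_id.smoothNear (T.incl U t)).exists_codRestrict (U := U) t.2
  have hGt : G (T.incl U t) = t := Subtype.ext hGe.self_of_nhds
  refine ⟨F ∘ G, hF.comp_of_eq hG hGt, congrArg F hGt, ?_⟩
  have hG' : Filter.Tendsto G (𝓝 (T.incl U t)) (𝓝 t) := by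
    have := hG.continuousAt.tendsto
    rwa [hGt] at this
  filter_upwards [hGe, hG'.eventually e] with z h1 h2
  exact h2.trans (congrArg p h1)

end Immersed

/-- The first projection of a product of manifolds is a submersion. -/
theorem SmoothMfd.isSubmersionAt_fst (M N : SmoothMfd.{u}) (z : M.prod N) :
    Manifold.IsSubmersionAt (M := M.prod N) (N := M) 𝓘(ℝ, (M.prod N).E) 𝓘(ℝ, M.E) ∞
      (Prod.fst : M × N → M) z := by
  refine Manifold.IsSubmersionAt.mk_of_charts (M := M.prod N) (N := M)
    (ContinuousLinearEquiv.refl ℝ (M.E × N.E))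
    (chartAt (M.prod N).E z) (chartAt M.E (Prod.fst (α := M) (β := N) z)) (mem_chart_source _ _)
    (mem_chart_source _ _) (IsManifold.chart_mem_maximalAtlas _)
    (IsManifold.chart_mem_maximalAtlas _) (fun z hz => hz.1) ?_
  intro v hv
  have hv : v ∈ (chartAt (M.prod N).E z).target := by simpa using hv
  exact (chartAt M.E (Prod.fst (α := M) (β := N) z)).right_inv hv.1

/-! ### Algebra in groupoids -/

namespace GroupoidOver

section Algebra

variable {𝒢 M : Type u} (Γ : GroupoidOver 𝒢 M)

theorem one_mul_of_eq {x : M} {g : 𝒢} (h : x = Γ.tgt g) (e) : Γ.mul (Γ.one x) g e = g := by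
  subst h
  exact Γ.one_mul g

theorem mul_one_of_eq {x : M} {g : 𝒢} (h : x = Γ.src g) (e) : Γ.mul g (Γ.one x) e = g := by
  subst h
  exact Γ.mul_one g

theorem inv_mul_cancel_left (g h : 𝒢) (e e') : Γ.mul (Γ.inv g) (Γ.mul g h e) e' = h := by
  rw [← Γ.mul_assoc _ _ _ (Γ.src_inv g) e]
  simp only [Γ.inv_mul]
  exact Γ.one_mul_of_eq e _

theorem mul_inv_cancel_left (g h : 𝒢) (e e') : Γ.mul g (Γ.mul (Γ.inv g) h e) e' = h := by
  rw [← Γ.mul_assoc _ _ _ (Γ.tgt_inv g).symm e]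
  simp only [Γ.mul_inv]
  exact Γ.one_mul_of_eq ((Γ.src_inv g).symm.trans e) _

theorem inv_mul_cancel_right (g h : 𝒢) (e e') : Γ.mul (Γ.mul g (Γ.inv h) e) h e' = g := by
  rw [Γ.mul_assoc _ _ _ e (Γ.src_inv h)]
  simp only [Γ.inv_mul]
  exact Γ.mul_one_of_eq ((Γ.tgt_inv h).symm.trans e.symm) _

theorem mul_inv_cancel_right (g h : 𝒢) (e e') : Γ.mul (Γ.mul g h e) (Γ.inv h) e' = g := by
  rw [Γ.mul_assoc _ _ _ e (Γ.tgt_inv h).symm]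
  simp only [Γ.mul_inv]
  exact Γ.mul_one_of_eq e.symm _

theorem mul_left_cancel {g h h' : 𝒢} {e e'} (H : Γ.mul g h e = Γ.mul g h' e') : h = h' := by
  rw [← Γ.inv_mul_cancel_left g h e ((Γ.src_inv g).trans (Γ.tgt_mul _ _ _).symm),
    ← Γ.inv_mul_cancel_left g h' e' ((Γ.src_inv g).trans (Γ.tgt_mul _ _ _).symm)]
  simp only [H]

theorem mul_right_cancel {g g' h : 𝒢} {e e'} (H : Γ.mul g h e = Γ.mul g' h e') : g = g' := by
  rw [← Γ.mul_inv_cancel_right g h e ((Γ.src_mul _ _ _).trans (Γ.tgt_inv h).symm),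
    ← Γ.mul_inv_cancel_right g' h e' ((Γ.src_mul _ _ _).trans (Γ.tgt_inv h).symm)]
  simp only [H]

theorem coe_fibreAct {x : M} (h : Γ.srcFibre x) (g : Γ.isotropy x) :
    (Γ.fibreAct x h g : 𝒢) = Γ.mul h g (h.2.trans g.2.2.symm) := rfl

/-- The map `(g, h) ↦ gh⁻¹` on a source fibre. -/
def fibreDiv {x : M} (g h : Γ.srcFibre x) : 𝒢 :=
  Γ.mul g (Γ.inv h) ((g.2.trans h.2.symm).trans (Γ.tgt_inv h).symm)

variable {Γ} {x : M}

theorem src_fibreDiv (g h : Γ.srcFibre x) : Γ.src (Γ.fibreDiv g h) = Γ.tgt h :=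
  (Γ.src_mul _ _ _).trans (Γ.src_inv _)

theorem tgt_fibreDiv (g h : Γ.srcFibre x) : Γ.tgt (Γ.fibreDiv g h) = Γ.tgt g :=
  Γ.tgt_mul _ _ _

theorem fibreDiv_mul (g h : Γ.srcFibre x) :
    Γ.mul (Γ.fibreDiv g h) h (src_fibreDiv g h) = g :=
  Γ.inv_mul_cancel_right _ _ _ _

/-- Right cancellation makes gh⁻¹ the only arrow carrying `h` to `g`. Later identities between
quotients are checked through this characterization. -/
theorem fibreDiv_eq {k : 𝒢} {g h : Γ.srcFibre x} (e : Γ.src k = Γ.tgt h)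
    (H : Γ.mul k h e = g) : Γ.fibreDiv g h = k :=
  Γ.mul_right_cancel ((fibreDiv_mul g h).trans H.symm)

/-- The arrow carrying `h` to `g` also carries hk to gk, by associativity. This is what makes [g,h]
↦ gh⁻¹ well defined. -/
theorem fibreDiv_fibreAct (g h : Γ.srcFibre x) (k : Γ.isotropy x) :
    Γ.fibreDiv (Γ.fibreAct x g k) (Γ.fibreAct x h k) = Γ.fibreDiv g h := by
  refine fibreDiv_eq ((src_fibreDiv g h).trans (Γ.tgt_mul _ _ _).symm) ?_
  simp only [coe_fibreAct]
  rw [← Γ.mul_assoc _ _ _ (src_fibreDiv g h) (h.2.trans k.2.2.symm)]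
  simp only [fibreDiv_mul]

/-- Elements of a source fibre with the same target differ by an element of the isotropy group. -/
theorem exists_fibreAct {g h : Γ.srcFibre x} (e : Γ.tgt g = Γ.tgt h) :
    ∃ k, Γ.fibreAct x h k = g := by
  have e' : Γ.src (Γ.inv h) = Γ.tgt g := (Γ.src_inv _).trans e.symm
  refine ⟨⟨Γ.mul (Γ.inv h) g e', (Γ.src_mul _ _ _).trans g.2,
    (Γ.tgt_mul _ _ _).trans ((Γ.tgt_inv _).trans h.2)⟩, Subtype.ext ?_⟩
  exact Γ.mul_inv_cancel_left _ _ _ _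

theorem fibreAct_one (g : Γ.srcFibre x) : Γ.fibreAct x g 1 = g :=
  Subtype.ext (Γ.mul_one_of_eq g.2.symm _)

theorem fibreAct_mul (p : Γ.srcFibre x) (g h : Γ.isotropy x) :
    Γ.fibreAct x p (g * h) = Γ.fibreAct x (Γ.fibreAct x p g) h :=
  Subtype.ext (Γ.mul_assoc _ _ _ _ _).symm

theorem eq_one_of_fibreAct_eq {p : Γ.srcFibre x} {g : Γ.isotropy x}
    (h : Γ.fibreAct x p g = p) : g = 1 := by
  refine Subtype.ext (Γ.mul_left_cancel (g := p) (e := p.2.trans g.2.2.symm)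
    (e' := p.2.trans (Γ.tgt_one x).symm) ?_)
  exact (congrArg Subtype.val h).trans (Γ.mul_one_of_eq p.2.symm _).symm

end Algebra

section Smooth

variable {N : SmoothMfd.{u}} {𝒢 𝒢' : Type u} [Q : QManifold 𝒢] {Γ : GroupoidOver 𝒢 N}
  {S : Type u} [QManifold S]

/-- Smoothness of the multiplication is given on plots with composable values; since plots detect
Q-smoothness, it extends to composable families over any Q-manifold. -/
theorem IsQGroupoid.qSmooth_mul (hΓ : Γ.IsQGroupoid) {p q : S → 𝒢} (hp : QSmooth p)
    (hq : QSmooth q) (e : ∀ s, Γ.src (p s) = Γ.tgt (q s)) :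
    QSmooth fun s => Γ.mul (p s) (q s) (e s) :=
  .of_plots fun T c hc => hΓ.mul_smooth T (fun t => (p (c t), q (c t))) (fun t => e (c t))
    ((hp.comp_plot hc).prodMk_plot (hq.comp_plot hc))

/-- The target is the source of the inverse. -/
theorem IsQGroupoid.qSmooth_tgt (hΓ : Γ.IsQGroupoid) : QSmooth Γ.tgt := by
  have := hΓ.src_smooth.comp hΓ.inv_smooth
  simpa only [Γ.src_inv] using this

/-! ### Transport of Q-groupoids -/

theorem QSubmersion.comp_transport {S' : Type u} (e : S' ≃ 𝒢) {f : 𝒢 → S}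
    (hf : QSubmersion f) : QSubmersion (Q := Q.transport e) fun s => f (e s) := fun s => by
  obtain ⟨c, c', F, m, hc, hc', hm, eF, hF⟩ := hf (e s)
  refine ⟨c.transport e, c', F, m, hc.transport e, hc', ?_, ?_, hF⟩
  · exact (congrArg e.symm hm).trans (e.symm_apply_apply s)
  · exact funext fun z => (congrArg f (e.apply_symm_apply _)).trans (congrFun eF z)

/-- A groupoid which is isomorphic to a Q-groupoid is a Q-groupoid for the transported structure. -/
theorem IsQGroupoid.transport (hΓ : Γ.IsQGroupoid) {Γ' : GroupoidOver 𝒢' N} (Φ : 𝒢' ≃ 𝒢)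
    (src_map : ∀ g, Γ.src (Φ g) = Γ'.src g) (tgt_map : ∀ g, Γ.tgt (Φ g) = Γ'.tgt g)
    (mul_map : ∀ g h e, Φ (Γ'.mul g h e) =
      Γ.mul (Φ g) (Φ h) ((src_map g).trans (e.trans (tgt_map h).symm))) :
    letI := Q.transport Φ
    Γ'.IsQGroupoid ∧ IsQIsomorphism Γ' Γ Φ := by
  let Q' : QManifold 𝒢' := Q.transport Φ
  have hΦ : QSmooth Φ := qSmooth_transport Φ
  have hΦ' : QSmooth Φ.symm := qSmooth_transport_symm Φ
  -- The image of an identity is idempotent, and an idempotent arrow is an identity by cancellation.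
  have one_map : ∀ x, Φ (Γ'.one x) = Γ.one x := fun x => by
    have h1 : Γ'.mul (Γ'.one x) (Γ'.one x) ((Γ'.src_one x).trans (Γ'.tgt_one x).symm) =
      Γ'.one x := Γ'.one_mul_of_eq (Γ'.tgt_one x).symm _
    have h2 := (mul_map _ _ _).symm.trans (congrArg Φ h1)
    have hs : Γ.src (Φ (Γ'.one x)) = x := (src_map _).trans (Γ'.src_one x)
    exact Γ.mul_left_cancel (e' := hs.trans (Γ.tgt_one x).symm)
      (h2.trans (Γ.mul_one_of_eq hs.symm _).symm)
  have inv_map : ∀ g, Φ (Γ'.inv g) = Γ.inv (Φ g) := fun g => by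
    have h2 := (mul_map _ _ _).symm.trans (congrArg Φ (Γ'.mul_inv g))
    refine Γ.mul_left_cancel (e' := (Γ.tgt_inv _).symm) (h2.trans ?_)
    rw [Γ.mul_inv, one_map, tgt_map]
  refine ⟨⟨?_, ?_, ?_, ?_, ?_⟩, ⟨?_, ?_, ?_, ?_, hΦ⟩, ⟨?_, ?_, ?_, ?_, hΦ'⟩⟩
  · have := hΓ.src_smooth.comp hΦ
    simpa only [src_map] using this
  · have := hΦ'.comp (hΓ.inv_smooth.comp hΦ)
    simpa only [← inv_map, Φ.symm_apply_apply] using this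
  · have := hΦ'.comp hΓ.one_smooth
    simpa only [← one_map, Φ.symm_apply_apply] using this
  · have := QSubmersion.comp_transport Φ hΓ.src_submersion
    simpa only [src_map] using this
  · intro T c hc hcs
    have := hΦ'.comp_plot (hΓ.qSmooth_mul (hΦ.comp_plot (QSmooth.fst.comp_plot hcs))
      (hΦ.comp_plot (QSmooth.snd.comp_plot hcs))
      fun t => (src_map _).trans ((hc t).trans (tgt_map _).symm))
    simpa only [← mul_map _ _ (hc _), Φ.symm_apply_apply] using this
  · exact src_map
  · exact tgt_map
  · exact mul_map
  · exact one_map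
  · exact fun g => (src_map _).symm.trans (congrArg Γ.src (Φ.apply_symm_apply g))
  · exact fun g => (tgt_map _).symm.trans (congrArg Γ.tgt (Φ.apply_symm_apply g))
  · intro g h e
    refine Φ.injective ?_
    rw [mul_map]
    simp only [Φ.apply_symm_apply]
  · exact fun x => Φ.injective ((Φ.apply_symm_apply _).trans (one_map x).symm)

end Smooth

end GroupoidOver

namespace GroupoidOver

/-! ### The principal bundle of a locally trivial Q-groupoid -/

section Bundle

variable {N : SmoothMfd.{u}} {𝒢 : Type u} [Q : QManifold 𝒢] {Γ : GroupoidOver 𝒢 N}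

/-- Local Q-smooth sections of the target map, with values in a source fibre. -/
theorem IsLocallyTrivial.exists_section (hΓ : Γ.IsLocallyTrivial) (x n : N) :
    ∃ (U : TopologicalSpace.Opens N) (σ : N.restrict U → 𝒢), n ∈ U ∧ QSmooth σ ∧
      ∀ u, Γ.src (σ u) = x ∧ Γ.tgt (σ u) = N.incl U u := by
  -- The product structure on `N × N` is read as the identity atlas of the product manifold, so that
  -- results on submersions to manifolds apply.
  have hs : QSubmersion (Q' := (N.prod N).instQManifold) (S' := N.prod N)
    (fun g => ((Γ.src g, Γ.tgt g) : N × N)) := hΓ.submersion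
  obtain ⟨g, hg⟩ := hΓ.surjective (x, n)
  obtain ⟨a, rfl⟩ := Q.surjective_atlas g
  obtain ⟨σ, hσ, -, e⟩ := hs.exists_section a
  have hg : ((Γ.src (Q.atlas.π a), Γ.tgt (Q.atlas.π a)) : N × N) = (x, n) := hg
  rw [hg] at hσ e
  -- Restricting a section of (s,t) to the slice {x} × N yields arrows with source exactly `x`.
  let j : N → N.prod N := fun z => ((x, z) : N × N)
  have hj : SmoothNear j n :=
    SmoothNear.prodMk (Filter.Eventually.of_forall fun _ => contMDiffAt_const)
      (smooth_id.smoothNear n)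
  have h1 : SmoothNear (σ ∘ j) n := hσ.comp_of_eq hj rfl
  obtain ⟨U, hU, hUo, hn⟩ := eventually_nhds_iff.1 (h1.and (hj.continuousAt.eventually e))
  refine ⟨⟨U, hUo⟩, fun u => Q.atlas.π (σ (j u.1)), hn,
    Q.isChartOf_atlas.qSmooth.comp_plot (p := fun u => σ (j (N.incl ⟨U, hUo⟩ u)))
      (qSmooth_iff_smooth.2 fun u => (hU u.1 u.2).1.comp u (smooth_incl _ u)), fun u => ?_⟩
  exact Prod.mk.inj (hU u.1 u.2).2

/-- The division map `(g, h) ↦ gh⁻¹` on a source fibre is Q-smooth. -/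
theorem IsQGroupoid.qSmooth_fibreDiv (hΓ : Γ.IsQGroupoid) {x : N} {S : Type u} [QManifold S]
    {p q : S → Γ.srcFibre x} (hp : QSmooth fun s => (p s : 𝒢)) (hq : QSmooth fun s => (q s : 𝒢)) :
    QSmooth fun s => Γ.fibreDiv (p s) (q s) :=
  hΓ.qSmooth_mul hp (hΓ.inv_smooth.comp hq) _

variable {x : N} [Q₁ : QManifold (Γ.srcFibre x)] [Q₂ : QManifold (Γ.isotropy x)]

omit Q₁ in
theorem IsQGroupoid.isQGroup_isotropy (hΓ : Γ.IsQGroupoid)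
    (h₂ : IsImmersedQSubmanifold (Γ.isotropy x) Q₂) : IsQGroup (Γ.isotropy x) where
  mul_smooth := h₂.qSmooth_of_val
    (hΓ.qSmooth_mul (h₂.qSmooth_val.comp QSmooth.fst) (h₂.qSmooth_val.comp QSmooth.snd) _)
  inv_smooth := h₂.qSmooth_of_val (hΓ.inv_smooth.comp h₂.qSmooth_val)

/-- The trivialization of `𝒢(x,-) → M` given by a local section. -/
def trivialization {U : TopologicalSpace.Opens N} (σ : N.restrict U → 𝒢)
    (hσ : ∀ u, Γ.src (σ u) = x ∧ Γ.tgt (σ u) = N.incl U u) :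
    ↥(Γ.tgtAt x ⁻¹' (U : Set N)) ≃ (N.restrict U) × Γ.isotropy x where
  toFun h := ((⟨Γ.tgt h.1, h.2⟩ : U), ⟨Γ.mul (Γ.inv (σ (⟨Γ.tgt h.1, h.2⟩ : U))) h.1
      ((Γ.src_inv _).trans (hσ _).2),
    (Γ.src_mul _ _ _).trans h.1.2, (Γ.tgt_mul _ _ _).trans ((Γ.tgt_inv _).trans (hσ _).1)⟩)
  invFun y := ⟨⟨Γ.mul (σ y.1) y.2 ((hσ _).1.trans y.2.2.2.symm), (Γ.src_mul _ _ _).trans y.2.2.1⟩,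
    by
      show Γ.tgt (Γ.mul _ _ _) ∈ U
      rw [Γ.tgt_mul, (hσ _).2]
      exact y.1.2⟩
  left_inv h := Subtype.ext (Subtype.ext (Γ.mul_inv_cancel_left _ _ _ _))
  right_inv := by
    rintro ⟨u, k⟩
    have hu : Γ.tgt (Γ.mul (σ u) k ((hσ _).1.trans k.2.2.symm)) = u.1 :=
      (Γ.tgt_mul _ _ _).trans (hσ _).2
    refine Prod.ext (Subtype.ext hu) (Subtype.ext ?_)
    simp only [hu]
    exact Γ.inv_mul_cancel_left _ _ _ _

/-- The source fibre of a locally trivial Q-groupoid is a Q-principal bundle. -/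
theorem IsLocallyTrivial.isQPrincipalBundle (hΓ : Γ.IsLocallyTrivial)
    (h₁ : IsImmersedQSubmanifold (Γ.srcFibre x) Q₁)
    (h₂ : IsImmersedQSubmanifold (Γ.isotropy x) Q₂) :
    IsQPrincipalBundle (Γ.fibreAct x) (Γ.tgtAt x) where
  isQGroup := hΓ.isQGroupoid.isQGroup_isotropy h₂
  act_one := fibreAct_one
  act_mul := fibreAct_mul
  act_free _ _ := eq_one_of_fibreAct_eq
  act_smooth := h₁.qSmooth_of_val (hΓ.isQGroupoid.qSmooth_mul
    (h₁.qSmooth_val.comp QSmooth.fst) (h₂.qSmooth_val.comp QSmooth.snd) _)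
  proj_smooth := hΓ.isQGroupoid.qSmooth_tgt.comp h₁.qSmooth_val
  fibre_eq_orbit p := by
    ext q
    refine ⟨fun h => exists_fibreAct h, ?_⟩
    rintro ⟨g, rfl⟩
    exact Γ.tgt_mul _ _ _
  locally_trivial n := by
    obtain ⟨U, σ, hn, hσs, hσ⟩ := hΓ.exists_section x n
    refine ⟨U, hn, trivialization σ hσ, ?_, ?_, fun p => rfl, ?_⟩
    · intro T c hc hcs
      have hc1 : QSmooth fun t => (c t : 𝒢) := h₁.qSmooth_val.comp_plot hcs
      have hu : QSmooth (S' := N.restrict U) fun t => (⟨Γ.tgt (c t), hc t⟩ : U) :=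
        QSmooth.codRestrict (hΓ.isQGroupoid.qSmooth_tgt.comp hc1)
      refine hu.prodMk (h₂.qSmooth_of_val ?_)
      exact hΓ.isQGroupoid.qSmooth_mul (hΓ.isQGroupoid.inv_smooth.comp (hσs.comp hu)) hc1 _
    · refine h₁.qSmooth_of_val ?_
      exact hΓ.isQGroupoid.qSmooth_mul (hσs.comp QSmooth.fst) (h₂.qSmooth_val.comp QSmooth.snd) _
    · rintro p ⟨p', hp'⟩ g (rfl : p' = _)
      have ht : Γ.tgt (Γ.fibreAct x p.1 g) = Γ.tgt p.1 := Γ.tgt_mul _ _ _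
      refine Prod.ext (Subtype.ext ht) (Subtype.ext ?_)
      show Γ.mul _ _ _ = Γ.mul (Γ.mul _ _ _) _ _
      simp only [ht]
      exact (Γ.mul_assoc _ _ _ _ _).symm

variable (B : IsQPrincipalBundle (Γ.fibreAct x) (Γ.tgtAt x))

/-- The map `[g, h] ↦ gh⁻¹`. -/
def gaugeDiv : B.GaugeSpace → 𝒢 :=
  Quotient.lift (fun a => Γ.fibreDiv a.1 a.2) (by
    rintro a _ ⟨g, rfl⟩
    exact (fibreDiv_fibreAct _ _ _).symm)

omit Q in
theorem gaugeDiv_mk (g h : Γ.srcFibre x) : gaugeDiv B (B.gaugeMk (g, h)) = Γ.fibreDiv g h := rfl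

-- Arrows that are equal as quotients have the same source, so their denominators differ by an
-- isotropy element; acting by it makes the denominators equal, and multiplying by them recovers the
-- numerators. For surjectivity, transitivity supplies an arrow `h` from `x` to the source of `k`,
-- and k = (kh)h⁻¹.
omit Q in
theorem gaugeDiv_bijective (hΓ : Function.Surjective fun g => (Γ.src g, Γ.tgt g)) :
    Function.Bijective (gaugeDiv B) := by
  constructor
  · intro a b e
    obtain ⟨⟨g, h⟩, rfl⟩ := B.gaugeMk_surjective a
    obtain ⟨⟨g', h'⟩, rfl⟩ := B.gaugeMk_surjective b
    rw [gaugeDiv_mk, gaugeDiv_mk] at e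
    have ht : Γ.tgt h' = Γ.tgt h := by rw [← src_fibreDiv g' h', ← e, src_fibreDiv]
    obtain ⟨k, rfl⟩ := exists_fibreAct ht
    refine B.gaugeMk_eq.2 ⟨k, Prod.ext (Subtype.ext ?_) rfl⟩
    rw [← fibreDiv_mul g' (Γ.fibreAct x h k), ← fibreDiv_mul (Γ.fibreAct x g k) (Γ.fibreAct x h k)]
    simp only [fibreDiv_fibreAct, e]
  · intro k
    obtain ⟨h, hh⟩ := hΓ (x, Γ.src k)
    obtain ⟨hs, ht⟩ := Prod.mk.inj hh
    exact ⟨B.gaugeMk (⟨Γ.mul k h ht.symm, (Γ.src_mul _ _ _).trans hs⟩, ⟨h, hs⟩),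
      fibreDiv_eq ht.symm rfl⟩

/-- The bijection `[g, h] ↦ gh⁻¹` from the gauge groupoid onto `𝒢`. -/
noncomputable def gaugeEquiv (hΓ : Function.Surjective fun g => (Γ.src g, Γ.tgt g)) :
    B.GaugeSpace ≃ 𝒢 :=
  Equiv.ofBijective (gaugeDiv B) (gaugeDiv_bijective B hΓ)

omit Q in
theorem gaugeEquiv_mk (hΓ : Function.Surjective fun g => (Γ.src g, Γ.tgt g))
    (g h : Γ.srcFibre x) : gaugeEquiv B hΓ (B.gaugeMk (g, h)) = Γ.fibreDiv g h := rfl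

/-- The gauge groupoid is a Q-groupoid isomorphic to `𝒢`. -/
theorem IsLocallyTrivial.isQGroupoid_gauge (hΓ : Γ.IsLocallyTrivial) :
    letI := Q.transport (gaugeEquiv B hΓ.surjective)
    B.gaugeGroupoid.IsQGroupoid ∧
      IsQIsomorphism B.gaugeGroupoid Γ (gaugeEquiv B hΓ.surjective) := by
  have src_map : ∀ a, Γ.src (gaugeEquiv B hΓ.surjective a) = B.gaugeGroupoid.src a := fun a => by
    obtain ⟨⟨g, h⟩, rfl⟩ := B.gaugeMk_surjective a
    exact src_fibreDiv g h
  have tgt_map : ∀ a, Γ.tgt (gaugeEquiv B hΓ.surjective a) = B.gaugeGroupoid.tgt a := fun a => by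
    obtain ⟨⟨g, h⟩, rfl⟩ := B.gaugeMk_surjective a
    exact tgt_fibreDiv g h
  refine hΓ.isQGroupoid.transport (gaugeEquiv B hΓ.surjective) src_map tgt_map fun a b e => ?_
  obtain ⟨⟨g, h⟩, rfl⟩ := B.gaugeMk_surjective a
  obtain ⟨k, rfl⟩ := B.exists_gaugeMk h b e
  have h1 : B.gaugeGroupoid.mul (B.gaugeMk (g, h)) (B.gaugeMk (h, k)) e = B.gaugeMk (g, k) :=
    B.gaugeMul_mk g h k e
  rw [h1]
  simp only [gaugeEquiv_mk]
  refine fibreDiv_eq ((Γ.src_mul _ _ _).trans (src_fibreDiv h k)) ?_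
  rw [Γ.mul_assoc _ _ _ ((src_fibreDiv g h).trans (tgt_fibreDiv h k).symm) (src_fibreDiv h k)]
  simp only [fibreDiv_mul]

/-- The quotient map `(g, h) ↦ [g, h] = gh⁻¹` is a Q-submersion: in a local trivialization it is
the projection of `𝒢 × 𝒢(x)` to `𝒢`. -/
theorem IsLocallyTrivial.qSubmersion_gaugeMk (hΓ : Γ.IsLocallyTrivial)
    (h₁ : IsImmersedQSubmanifold (Γ.srcFibre x) Q₁) :
    B.IsGaugeQManifold (Q.transport (gaugeEquiv B hΓ.surjective)) := by
  have hG := hΓ.isQGroupoid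
  rintro ⟨g₀, h₀⟩
  obtain ⟨U, hU, ψ, hψ, hψ', hβ, -⟩ := B.locally_trivial (Γ.tgt h₀)
  have hβ' : ∀ u k, Γ.tgt (ψ.symm (u, k)).1 = N.incl U u := fun u k =>
    (hβ _).symm.trans (by rw [ψ.apply_symm_apply])
  -- Only arrows with source in `U` are kept, since `ψ` has to produce a point of 𝒢(x,-) over that
  -- source.
  let c₀ : QChart 𝒢 := Q.atlas.restrict
    ⟨_, U.2.preimage (hG.src_smooth.comp_plot Q.isChartOf_atlas.qSmooth).continuous⟩
  have hc₀ : c₀.IsChartOf Q := Q.isChartOf_atlas.restrict _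
  have hU₀ : ∀ y : c₀.M, Γ.src (c₀.π y) ∈ U := fun y => y.2
  let W : SmoothMfd.{u} := c₀.M.prod Q₂.atlas.M
  let pr₁ : W → c₀.M := (Prod.fst : c₀.M × Q₂.atlas.M → c₀.M)
  let pr₂ : W → Q₂.atlas.M := (Prod.snd : c₀.M × Q₂.atlas.M → Q₂.atlas.M)
  have hpr₁ : Smooth pr₁ := smooth_fst _ _
  have hpr₂ : Smooth pr₂ := smooth_snd _ _
  let s : c₀.M → N.restrict U := fun y => (⟨Γ.src (c₀.π y), hU₀ y⟩ : U)
  -- The chart `w` sends an arrow k and an isotropy element to (kq, q), where q is the point over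
  -- s(k) with that isotropy coordinate. The quotient of this pair is k, so the quotient map lifts
  -- to `pr₁`.
  let q : W → Γ.srcFibre x := fun y => (ψ.symm (s (pr₁ y), Q₂.atlas.π (pr₂ y))).1
  have hq : ∀ y, Γ.src (c₀.π (pr₁ y)) = Γ.tgt (q y) := fun y => (hβ' (s (pr₁ y)) _).symm
  let p : W → Γ.srcFibre x := fun y =>
    ⟨Γ.mul (c₀.π (pr₁ y)) (q y) (hq y), (Γ.src_mul _ _ _).trans (q y).2⟩
  let w : W → Γ.srcFibre x × Γ.srcFibre x := fun y => (p y, q y)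
  have hdiv : ∀ y, Γ.fibreDiv (p y) (q y) = c₀.π (pr₁ y) := fun y => fibreDiv_eq (hq y) rfl
  have hs : QSmooth fun y => s (pr₁ y) := QSmooth.codRestrict
    ((hG.src_smooth.comp_plot hc₀.qSmooth).comp_plot (qSmooth_iff_smooth.2 hpr₁))
  have hqs : QSmooth q := hψ'.comp_plot
    (hs.prodMk (Q₂.isChartOf_atlas.qSmooth.comp_plot (qSmooth_iff_smooth.2 hpr₂)))
  have hps : QSmooth p := h₁.qSmooth_of_val
    (hG.qSmooth_mul (hc₀.qSmooth.comp_plot (qSmooth_iff_smooth.2 hpr₁))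
      (h₁.qSmooth_val.comp_plot hqs) hq)
  -- Both factors can be read off from the pair: k is the quotient, and the isotropy element is the
  -- second coordinate of q under `ψ`. Uniqueness of lifts in `c₀` and in the atlas of 𝒢(x) then
  -- suffices.
  have hunique : HasUniqueLifts w := by
    intro T f h t hf hh e et
    have e1 : c₀.π ∘ (pr₁ ∘ f) =ᶠ[𝓝 t] c₀.π ∘ (pr₁ ∘ h) := by
      filter_upwards [e] with z hz
      have hz : (p (f z), q (f z)) = (p (h z), q (h z)) := hz
      obtain ⟨hz1, hz2⟩ := Prod.mk.inj hz
      show c₀.π (pr₁ (f z)) = c₀.π (pr₁ (h z))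
      rw [← hdiv, ← hdiv, hz1, hz2]
    have e2 : Q₂.atlas.π ∘ (pr₂ ∘ f) =ᶠ[𝓝 t] Q₂.atlas.π ∘ (pr₂ ∘ h) := by
      filter_upwards [e] with z hz
      have hz : (p (f z), q (f z)) = (p (h z), q (h z)) := hz
      exact (Prod.mk.inj (ψ.symm.injective (Subtype.ext (Prod.mk.inj hz).2))).2
    filter_upwards [c₀.isQChart.eventuallyEq ((hpr₁.smoothNear _).comp hf)
      ((hpr₁.smoothNear _).comp hh) e1 (congrArg pr₁ et),
      Q₂.atlas.isQChart.eventuallyEq ((hpr₂.smoothNear _).comp hf)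
      ((hpr₂.smoothNear _).comp hh) e2 (congrArg pr₂ et)] with z h1 h2
    exact Prod.ext h1 h2
  have lift : ∀ (T : SmoothMfd.{u}) (r : T → Γ.srcFibre x × Γ.srcFibre x) (t : T) (y : W),
      QSmooth r → w y = r t → ∃ F : T → W, SmoothNear F t ∧ F t = y ∧ w ∘ F =ᶠ[𝓝 t] r := by
    intro T r t y hr e
    have hr1 : QSmooth fun z => (r z).1 := QSmooth.fst.comp_plot hr
    have hr2 : QSmooth fun z => (r z).2 := QSmooth.snd.comp_plot hr
    have et1 : p y = (r t).1 := congrArg Prod.fst e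
    have et2 : q y = (r t).2 := congrArg Prod.snd e
    -- The coordinates of the plot exist only where its second component lies over `U`; they are
    -- lifted on this open set, and the lift is extended afterwards.
    let U' : TopologicalSpace.Opens T :=
      ⟨_, U.2.preimage (B.proj_smooth.comp_plot hr2).continuous⟩
    have ht : t ∈ U' := by
      show Γ.tgt (r t).2 ∈ U
      rw [← et2, ← hq]
      exact hU₀ _
    let t' : T.restrict U' := (⟨t, ht⟩ : U')
    have hr1' := hr1.comp_plot (qSmooth_incl U')
    have hr2' := hr2.comp_plot (qSmooth_incl U')
    have hk : QSmooth fun z => Γ.fibreDiv (r (T.incl U' z)).1 (r (T.incl U' z)).2 :=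
      hG.qSmooth_fibreDiv (h₁.qSmooth_val.comp_plot hr1') (h₁.qSmooth_val.comp_plot hr2')
    have hb := QSmooth.snd.comp_plot (hψ (T.restrict U') _ (fun z => z.2) hr2')
    obtain ⟨F₁, hF₁, F₁t, eF₁⟩ := hk.exists_lift hc₀ (t := t') (m := pr₁ y) (by
      rw [← hdiv, et1, et2]; rfl)
    obtain ⟨F₂, hF₂, F₂t, eF₂⟩ := hb.exists_lift Q₂.isChartOf_atlas (t := t') (m := pr₂ y) (by
      have h1 : (⟨(r t).2, ht⟩ : ↥(Γ.tgtAt x ⁻¹' (U : Set N))) =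
          ψ.symm (s (pr₁ y), Q₂.atlas.π (pr₂ y)) := Subtype.ext et2.symm
      show Q₂.atlas.π (pr₂ y) = (ψ ⟨(r t).2, ht⟩).2
      rw [h1, ψ.apply_symm_apply])
    have := exists_extend_lift (w := w) (p := r) (hF₁.prodMk hF₂) (by
      filter_upwards [eF₁, eF₂] with z hz₁ hz₂
      have hz₁ : c₀.π (F₁ z) = Γ.fibreDiv (r (T.incl U' z)).1 (r (T.incl U' z)).2 := hz₁
      have hz₂ : Q₂.atlas.π (F₂ z) = (ψ ⟨(r (T.incl U' z)).2, z.2⟩).2 := hz₂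
      have h2 : s (F₁ z) = (ψ ⟨(r (T.incl U' z)).2, z.2⟩).1 := by
        refine Subtype.ext ?_
        refine Eq.trans ?_ (hβ _).symm
        show Γ.src (c₀.π (F₁ z)) = Γ.tgt (r (T.incl U' z)).2
        rw [hz₁, src_fibreDiv]
      have h3 : q ((F₁ z, F₂ z) : c₀.M × Q₂.atlas.M) = (r (T.incl U' z)).2 := by
        show (ψ.symm (s (F₁ z), Q₂.atlas.π (F₂ z))).1 = _
        rw [h2, hz₂]
        exact congrArg Subtype.val (ψ.symm_apply_apply _)
      refine Prod.ext (Subtype.ext ?_) h3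
      show Γ.mul (c₀.π (F₁ z)) (q ((F₁ z, F₂ z) : c₀.M × Q₂.atlas.M)) _ = (r (T.incl U' z)).1
      simp only [hz₁, h3, fibreDiv_mul])
    obtain ⟨F, hF, Ft, eF⟩ := this
    refine ⟨F, hF, Ft.trans (Prod.ext F₁t F₂t), eF⟩
  obtain ⟨hw, hwc⟩ := exists_isChartOf (hps.prodMk hqs) hunique lift
  have hk₀ : Γ.src (Γ.fibreDiv g₀ h₀) = Γ.tgt h₀ := src_fibreDiv g₀ h₀
  obtain ⟨a, ha⟩ := Q.surjective_atlas (Γ.fibreDiv g₀ h₀)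
  obtain ⟨b, hb⟩ := Q₂.surjective_atlas (ψ ⟨h₀, hU⟩).2
  have haU : Γ.src (Q.atlas.π a) ∈ U := by rw [ha, hk₀]; exact hU
  let a' : c₀.M := ⟨a, haU⟩
  have ha' : c₀.π a' = Γ.fibreDiv g₀ h₀ := ha
  refine ⟨⟨W, w, hw⟩, c₀.transport (gaugeEquiv B hΓ.surjective), pr₁,
    ((a', b) : c₀.M × Q₂.atlas.M), hwc, hc₀.transport _, ?_, ?_, hpr₁, isSubmersionAt_fst _ _ _⟩
  · have h3 : q ((a', b) : c₀.M × Q₂.atlas.M) = h₀ := by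
      have : (s a', Q₂.atlas.π b) = ψ ⟨h₀, hU⟩ := by
        refine Prod.ext (Subtype.ext ?_) hb
        refine Eq.trans ?_ (hβ _).symm
        show Γ.src (c₀.π a') = Γ.tgt h₀
        rw [ha', hk₀]
      show (ψ.symm (s a', Q₂.atlas.π b)).1 = h₀
      rw [this, ψ.symm_apply_apply]
    refine Prod.ext (Subtype.ext ?_) h3
    show Γ.mul (c₀.π a') (q ((a', b) : c₀.M × Q₂.atlas.M)) _ = g₀
    simp only [ha', h3, fibreDiv_mul]
  · funext y
    refine ((gaugeEquiv B hΓ.surjective).symm_apply_eq.2 ?_).symm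
    exact (hdiv y).symm

end Bundle

end GroupoidOver

/-! ### The case of an empty base -/

/-- The one-point manifold. -/
noncomputable def SmoothMfd.point : SmoothMfd.{u} :=
  letI : ChartedSpace (EuclideanSpace ℝ (Fin 0)) PUnit.{u + 1} := ChartedSpace.ofDiscreteTopology
  { E := EuclideanSpace ℝ (Fin 0)
    carrier := PUnit.{u + 1}
    smooth := IsManifold.of_discreteTopology _ }

theorem QSmooth.of_isEmpty {S S' : Type u} [QManifold S] [QManifold S'] [IsEmpty S] (f : S → S') :
    QSmooth f := fun s => isEmptyElim s

namespace GroupoidOver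

/-- Without a base point there is no source fibre to use. The total space 𝒢 is then empty too, and
serves as a bundle with trivial structure group; every condition other than that of a Q-group is
vacuous. -/
theorem exists_gauge_of_isEmpty {N : SmoothMfd.{u}} {𝒢 : Type u} [Q : QManifold 𝒢] [IsEmpty N]
    (Γ : GroupoidOver 𝒢 N) (hΓ : Γ.IsQGroupoid) :
    ∃ (P G : Type u) (_ : QManifold P) (_ : Group G) (_ : QManifold G)
      (act : P → G → P) (β : P → N) (B : IsQPrincipalBundle act β)
      (Q : QManifold B.GaugeSpace) (Φ : B.GaugeSpace ≃ 𝒢),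
        B.IsGaugeQManifold Q ∧ B.gaugeGroupoid.IsQGroupoid ∧
        IsQIsomorphism B.gaugeGroupoid Γ Φ := by
  have : IsEmpty 𝒢 := Function.isEmpty Γ.src
  have : IsEmpty (𝒢 × PUnit.{u + 1}) := Function.isEmpty Prod.fst
  let QG : QManifold PUnit.{u + 1} := SmoothMfd.point.instQManifold
  have B : IsQPrincipalBundle (fun (p : 𝒢) (_ : PUnit.{u + 1}) => p) Γ.src :=
    { isQGroup := ⟨QSmooth.const _, QSmooth.const _⟩
      act_one := fun _ => rfl
      act_mul := fun _ _ _ => rfl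
      act_free := fun p => isEmptyElim p
      act_smooth := .of_isEmpty _
      proj_smooth := .of_isEmpty _
      fibre_eq_orbit := fun p => isEmptyElim p
      locally_trivial := fun n => isEmptyElim n }
  have : IsEmpty B.GaugeSpace := Function.isEmpty B.gaugeSrc
  refine ⟨𝒢, PUnit.{u + 1}, Q, inferInstance, QG, _, _, B,
    Q.transport (Equiv.equivOfIsEmpty _ _), Equiv.equivOfIsEmpty _ _,
    fun s => isEmptyElim s.1, hΓ.transport _ (fun g => isEmptyElim g) (fun g => isEmptyElim g)
      fun g => isEmptyElim g⟩

end GroupoidOver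

/-! ### The structure theorem for locally trivial Q-groupoids -/

theorem theorem8p3 {N : SmoothMfd.{u}} {𝒢 : Type u} [QManifold 𝒢] (Γ : GroupoidOver 𝒢 N)
    (hΓ : Γ.IsLocallyTrivial) :
    (∃ (P G : Type u) (_ : QManifold P) (_ : Group G) (_ : QManifold G)
      (act : P → G → P) (β : P → N) (B : IsQPrincipalBundle act β)
      (Q : QManifold B.GaugeSpace) (Φ : B.GaugeSpace ≃ 𝒢),
        B.IsGaugeQManifold Q ∧ B.gaugeGroupoid.IsQGroupoid ∧
        GroupoidOver.IsQIsomorphism B.gaugeGroupoid Γ Φ) ∧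
    ∀ x : N, ∃ (Q₁ : QManifold (Γ.srcFibre x)) (Q₂ : QManifold (Γ.isotropy x)),
      IsImmersedQSubmanifold (Γ.srcFibre x) Q₁ ∧ IsImmersedQSubmanifold (Γ.isotropy x) Q₂ ∧
      ∃ (B : IsQPrincipalBundle (Γ.fibreAct x) (Γ.tgtAt x))
        (Q : QManifold B.GaugeSpace) (Φ : B.GaugeSpace ≃ 𝒢),
        B.IsGaugeQManifold Q ∧ B.gaugeGroupoid.IsQGroupoid ∧
        GroupoidOver.IsQIsomorphism B.gaugeGroupoid Γ Φ ∧
        ∀ g h : Γ.srcFibre x, Φ (B.gaugeMk (g, h)) =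
          Γ.mul g (Γ.inv h) ((g.2.trans h.2.symm).trans (Γ.tgt_inv h).symm) := by
  have fibres : ∀ x : N, ∃ (Q₁ : QManifold (Γ.srcFibre x)) (Q₂ : QManifold (Γ.isotropy x)),
      IsImmersedQSubmanifold (Γ.srcFibre x) Q₁ ∧ IsImmersedQSubmanifold (Γ.isotropy x) Q₂ ∧
      ∃ (B : IsQPrincipalBundle (Γ.fibreAct x) (Γ.tgtAt x))
        (Q : QManifold B.GaugeSpace) (Φ : B.GaugeSpace ≃ 𝒢),
        B.IsGaugeQManifold Q ∧ B.gaugeGroupoid.IsQGroupoid ∧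
        GroupoidOver.IsQIsomorphism B.gaugeGroupoid Γ Φ ∧
        ∀ g h : Γ.srcFibre x, Φ (B.gaugeMk (g, h)) =
          Γ.mul g (Γ.inv h) ((g.2.trans h.2.symm).trans (Γ.tgt_inv h).symm) := by
    intro x
    obtain ⟨Q₁, h₁⟩ := hΓ.isQGroupoid.src_submersion.exists_fibre x (Γ.srcFibre x)
      fun _ => Iff.rfl
    have hs : QSubmersion (Q' := (N.prod N).instQManifold) (S' := N.prod N)
      (fun g => ((Γ.src g, Γ.tgt g) : N × N)) := hΓ.submersion
    obtain ⟨Q₂, h₂⟩ := hs.exists_fibre ((x, x) : N × N) (Γ.isotropy x) fun _ => Prod.mk_inj.symm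
    have B := hΓ.isQPrincipalBundle h₁ h₂
    have hB := hΓ.isQGroupoid_gauge B
    exact ⟨Q₁, Q₂, h₁, h₂, B, _, GroupoidOver.gaugeEquiv B hΓ.surjective,
      hΓ.qSubmersion_gaugeMk B h₁, hB.1, hB.2, fun g h => rfl⟩
  refine ⟨?_, fibres⟩
  -- Any base point yields a bundle; only an empty base needs a separate one.
  rcases isEmpty_or_nonempty N with hN | ⟨⟨x⟩⟩
  · exact Γ.exists_gauge_of_isEmpty hΓ.isQGroupoid
  · obtain ⟨Q₁, Q₂, -, -, B, Q, Φ, hQ, hB, hΦ, -⟩ := fibres x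
    exact ⟨_, _, Q₁, inferInstance, Q₂, _, _, B, Q, Φ, hQ, hB, hΦ⟩
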